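/- Let $M$ be a connected smooth manifold of dimension $n$, let $h=\langle\cdot,\cdot\rangle$ be a smooth Riemannian metric on $M$ with Levi-Civita connection $\nabla$, and let $W$ be a smooth vector field on $M$ with $\|W\|<1$ everywhere. Put $\lambda=1-\|W\|^2$ and let $$\mathcal F(y)=\frac{\sqrt{\langle y,W\rangle^2+\lambda\|y\|^2}-\langle y,W\rangle}{\lambda}$$ be the associated Randers metric. For a curve $c$ from $p$ to $q$ consider the following translations of nonzero vectors of $T_pM$ to $T_qM$ along $c$: * the Riemannian parallel translation $\mathcal P_R$ of $h$; * the natural parallel translation $\mathcal P(v)=\mathcal F(v)\bigl(\mathcal P_R(v/\mathcal F(v)-W_p)+W_q\bigr)$; * the Finslerian parallel translation of $\mathcal F$, defined by the vector fields $y(t)\neq 0$ along $c$ with $\dot y^k+\Gamma^k_i(c,y)\,\dot c^i=0$, where $\Gamma^k_i=\partial G^k/\partial y^i$ are the coefficients of the canonical connection of $\mathcal F$ and $G^k=\tfrac12 g^{kl}\bigl(\tfrac{\partial^2E}{\partial x^m\partial y^l}y^m-\tfrac{\partial E}{\partial x^l}\bigr)$ are its spray coefficients, with $E=\tfrac12\mathcal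 F^2$ and $g_{ij}=\tfrac{\partial^2E}{\partial y^i\partial y^j}$. Two of these translations are said to coincide if they agree on all nonzero vectors along all curves $c\colon[a,b]\to M$ of class $C^r$, where $1\le r\le\infty$ is fixed. Then: 1. If $n\neq 1$, the Finslerian parallel translation of $\mathcal F$ and the natural parallel translation coincide if and only if $W$ is $h$-parallel, i.e. $\nabla W=0$. 2. In every dimension, if $W$ is $h$-parallel, then the natural, the Riemannian and the Finslerian parallel translations all coincide, and $\mathcal F$ is a Berwald metric, i.e. its coefficients $\Gamma^k_i(x,y)$ are linear in $y$. -/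

import Mathlib

open scoped Manifold ContDiff Bundle

noncomputable section

namespace Navigation

/-- The coordinate space `ℝⁿ`. -/
abbrev Coord (n : ℕ) : Type := EuclideanSpace ℝ (Fin n)

/-- The partial derivative `∂f/∂xⁱ` of a real function on `ℝⁿ`. -/
def partialDeriv {n : ℕ} (i : Fin n) (f : Coord n → ℝ) (x : Coord n) : ℝ :=
  fderiv ℝ f x (EuclideanSpace.single i 1)

section Manifold

variable {n : ℕ} {M : Type*} [TopologicalSpace M] [ChartedSpace (Coord n) M]
  [IsManifold (𝓡 n) ∞ M]

/-! ### Local coordinates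

The chart with index `p` is the preferred chart of `M` at the point `p`. Its coordinates `xⁱ`
induce the coordinates `(xⁱ, yⁱ)` on the tangent bundle. -/

/-- The point of `M` with coordinates `x` in the chart at `p`. -/
def chartPoint (p : M) (x : Coord n) : M := (extChartAt (𝓡 n) p).symm x

/-- The tangent vector `yⁱ ∂/∂xⁱ` at the point with coordinates `x`, in the chart at `p`. -/
def chartVector (p : M) (x y : Coord n) : TangentSpace (𝓡 n) (chartPoint p x) :=
  (trivializationAt (Coord n) (TangentSpace (𝓡 n) : M → Type _) p).symmL ℝ (chartPoint p x) y

/-- The fibre coordinates `yⁱ` of a tangent vector `v` at `q`, in the chart at `p`. -/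
def vectorCoord (p q : M) (v : TangentSpace (𝓡 n) q) : Coord n :=
  (trivializationAt (Coord n) (TangentSpace (𝓡 n) : M → Type _) p).continuousLinearMapAt ℝ q v

/-! ### Connections and parallel vector fields along curves -/

variable (n M) in
/-- The coefficients of a (possibly nonlinear) connection: `Γ p x y k i` is the coefficient
`Γᵏᵢ(x, y)` in the chart at `p`. -/
abbrev ConnectionCoeff : Type _ := M → Coord n → Coord n → Fin n → Fin n → ℝ

/-- The vector field `V` along `c : [a, b] → M` is parallel with respect to the connection with
coefficients `Γ`: in local coordinates `dyᵏ/dt + Γᵏᵢ(x(t), y(t)) dxⁱ/dt = 0`. -/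
def IsParallelAlong (Γ : ConnectionCoeff n M) (c : ℝ → M) (a b : ℝ)
    (V : ∀ t, TangentSpace (𝓡 n) (c t)) : Prop :=
  ∀ (p : M), ∀ t ∈ Set.Icc a b, c t ∈ (chartAt (Coord n) p).source → ∀ k : Fin n,
    HasDerivWithinAt (fun s => vectorCoord p (c s) (V s) k)
      (-∑ i, Γ p (extChartAt (𝓡 n) p (c t)) (vectorCoord p (c t) (V t)) k i *
        derivWithin (fun s => extChartAt (𝓡 n) p (c s) i) (Set.Icc a b) t)
      (Set.Icc a b) t

/-! ### Riemannian geometry -/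

variable (n M) in
/-- Smooth Riemannian metrics on `M`. -/
abbrev Metric : Type _ :=
  Bundle.ContMDiffRiemannianMetric (𝓡 n) ∞ (Coord n) (TangentSpace (𝓡 n) : M → Type _)

/-- The matrix `h_ij(x)` of the metric in the chart at `p`. -/
def metricMatrix (h : Metric n M) (p : M) (x : Coord n) : Matrix (Fin n) (Fin n) ℝ :=
  Matrix.of fun i j => h.inner (chartPoint p x)
    (chartVector p x (EuclideanSpace.single i 1)) (chartVector p x (EuclideanSpace.single j 1))

/-- The Christoffel symbols `Aᵏᵢⱼ(x)` of the Levi-Civita connection of `h`. -/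
def christoffel (h : Metric n M) (p : M) (x : Coord n) (k i j : Fin n) : ℝ :=
  (1 / 2) * ∑ l, (metricMatrix h p x)⁻¹ k l *
    (partialDeriv i (fun z => metricMatrix h p z j l) x
      + partialDeriv j (fun z => metricMatrix h p z i l) x
      - partialDeriv l (fun z => metricMatrix h p z i j) x)

/-- The Levi-Civita connection as a connection with coefficients `Aᵏᵢⱼ(x) yʲ`. -/
def leviCivitaCoeff (h : Metric n M) : ConnectionCoeff n M :=
  fun p x y k i => ∑ j, christoffel h p x k i j * y j

/-- The Riemannian parallel translation along `c : [a, b] → M` takes `v` to `w`. -/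
def RiemannTranslates (h : Metric n M) (c : ℝ → M) (a b : ℝ)
    (v : TangentSpace (𝓡 n) (c a)) (w : TangentSpace (𝓡 n) (c b)) : Prop :=
  ∃ V : ∀ t, TangentSpace (𝓡 n) (c t),
    IsParallelAlong (leviCivitaCoeff h) c a b V ∧ V a = v ∧ V b = w

/-- `W` is `h`-parallel: `∇W = 0`, i.e. `∂Wᵏ/∂xⁱ + Aᵏᵢⱼ Wʲ = 0` in local coordinates. -/
def IsParallelField (h : Metric n M) (W : ∀ x : M, TangentSpace (𝓡 n) x) : Prop :=
  ∀ (p : M), ∀ x ∈ (extChartAt (𝓡 n) p).target, ∀ k i : Fin n,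
    partialDeriv i (fun z => vectorCoord p (chartPoint p z) (W (chartPoint p z)) k) x
      + ∑ j, christoffel h p x k i j *
        vectorCoord p (chartPoint p x) (W (chartPoint p x)) j = 0

/-! ### Finsler geometry -/

/-- The energy `E = F² / 2` of a Finsler function, in the coordinates `(x, y)`. -/
def energy (F : ∀ x : M, TangentSpace (𝓡 n) x → ℝ) (p : M) (x y : Coord n) : ℝ :=
  (1 / 2) * F (chartPoint p x) (chartVector p x y) ^ 2

/-- The metric tensor `g_ij(x, y) = ∂²E/∂yⁱ∂yʲ`. -/
def finslerMatrix (F : ∀ x : M, TangentSpace (𝓡 n) x → ℝ) (p : M) (x y : Coord n) :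
    Matrix (Fin n) (Fin n) ℝ :=
  Matrix.of fun i j => partialDeriv i (fun z => partialDeriv j (fun u => energy F p x u) z) y

/-- The coefficients `Gᵏ = ½ gᵏˡ (∂²E/∂xᵐ∂yˡ yᵐ - ∂E/∂xˡ)` of the geodesic spray
`S = yᵏ ∂/∂xᵏ - 2Gᵏ ∂/∂yᵏ` of `F`. -/
def sprayCoeff (F : ∀ x : M, TangentSpace (𝓡 n) x → ℝ) (p : M) (x y : Coord n) (k : Fin n) : ℝ :=
  (1 / 2) * ∑ l, (finslerMatrix F p x y)⁻¹ k l *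
    ((∑ m, partialDeriv m (fun z => partialDeriv l (fun u => energy F p z u) y) x * y m)
      - partialDeriv l (fun z => energy F p z y) x)

/-- The canonical connection `[J, S]` of `F`, with coefficients `∂Gᵏ/∂yⁱ`. -/
def finslerCoeff (F : ∀ x : M, TangentSpace (𝓡 n) x → ℝ) : ConnectionCoeff n M :=
  fun p x y k i => partialDeriv i (fun z => sprayCoeff F p x z k) y

/-- The parallel translation of the Finsler metric `F` along `c : [a, b] → M` takes the nonzero
vector `v` to `w`. The canonical connection is considered on `TM ∖ {0}`. -/
def FinslerTranslates (F : ∀ x : M, TangentSpace (𝓡 n) x → ℝ) (c : ℝ → M) (a b : ℝ)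
    (v : TangentSpace (𝓡 n) (c a)) (w : TangentSpace (𝓡 n) (c b)) : Prop :=
  ∃ V : ∀ t, TangentSpace (𝓡 n) (c t), (∀ t ∈ Set.Icc a b, V t ≠ 0) ∧
    IsParallelAlong (finslerCoeff F) c a b V ∧ V a = v ∧ V b = w

/-- `F` is a Berwald metric: its canonical connection is linear, that is, its coefficients are
linear in `y`. -/
def IsBerwald (F : ∀ x : M, TangentSpace (𝓡 n) x → ℝ) : Prop :=
  ∀ (p : M), ∀ x ∈ (extChartAt (𝓡 n) p).target, ∃ B : Fin n → Fin n → Fin n → ℝ,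
    ∀ y : Coord n, y ≠ 0 → ∀ k i, finslerCoeff F p x y k i = ∑ j, B k i j * y j

/-! ### Navigation data -/

/-- `(h, W)` is a navigation data: `W` is a smooth vector field with `h(W, W) < 1`. -/
structure IsNavigationData (h : Metric n M) (W : ∀ x : M, TangentSpace (𝓡 n) x) : Prop where
  smooth : ContMDiff (𝓡 n) (𝓡 n).tangent ∞ fun x => (⟨x, W x⟩ : TangentBundle (𝓡 n) M)
  norm_lt_one : ∀ x, h.inner x (W x) (W x) < 1

/-- The Randers norm `F(x, y) = (√(⟨y, W⟩² + λ‖y‖²) - ⟨y, W⟩) / λ` with `λ = 1 - ‖W‖²`. -/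
def randers (h : Metric n M) (W : ∀ x : M, TangentSpace (𝓡 n) x) (x : M)
    (y : TangentSpace (𝓡 n) x) : ℝ :=
  (Real.sqrt (h.inner x y (W x) ^ 2 + (1 - h.inner x (W x) (W x)) * h.inner x y y)
    - h.inner x y (W x)) / (1 - h.inner x (W x) (W x))

/-- The natural parallel translation along `c : [a, b] → M` takes the nonzero vector `v` to `w`:
`w = F(v) • (P_R (v / F(v) - W) + W)`, where `P_R` is the Riemannian parallel translation. -/
def NaturalTranslates (h : Metric n M) (W : ∀ x : M, TangentSpace (𝓡 n) x) (c : ℝ → M) (a b : ℝ)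
    (v : TangentSpace (𝓡 n) (c a)) (w : TangentSpace (𝓡 n) (c b)) : Prop :=
  v ≠ 0 ∧ ∃ u : TangentSpace (𝓡 n) (c b),
    RiemannTranslates h c a b ((randers h W (c a) v)⁻¹ • v - W (c a)) u ∧
    w = randers h W (c a) v • (u + W (c b))

/-- Two parallel translations, given as relations between the tangent vectors at the end points,
coincide on nonzero vectors along all curves `c : [a, b] → M` of class `C^r`. -/
def Coincide (r : ℕ∞)
    (P Q : ∀ (c : ℝ → M) (a b : ℝ), TangentSpace (𝓡 n) (c a) → TangentSpace (𝓡 n) (c b) → Prop) :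
    Prop :=
  ∀ (c : ℝ → M) (a b : ℝ), a < b → ContMDiffOn 𝓘(ℝ, ℝ) (𝓡 n) r c (Set.Icc a b) →
    ∀ (v : TangentSpace (𝓡 n) (c a)) (w : TangentSpace (𝓡 n) (c b)), v ≠ 0 →
      (P c a b v w ↔ Q c a b v w)

end Manifold

end Navigation

end

/-! The Randers norm solves Zermelo's problem: `F(y)` is the positive number with `‖y / F(y) - W‖ =
1`, so the indicatrix of `F` is the unit sphere of `h` shifted by `W`.

Suppose the Finslerian and natural translations coincide. Differentiating the natural translate
`F(y) (U(t) + W)` at `t = 0` along coordinate lines, with `U` Riemannian parallel and `U(0) = y /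
F(y) - W`, gives `∂Gᵏ/∂yⁱ = Aᵏᵢⱼ yʲ - F(y) (∇ᵢW)ᵏ` (`finslerCoeff_of_coincide`). No existence
theorem for Finslerian parallel fields is needed: the coincidence itself supplies one. For fixed `x`
and `k`, the one-form `γ(y, ·) - F(y) b`, with `γ` symmetric bilinear and `b = (∇W)ᵏ`, is therefore
the differential in `y` of `Gᵏ`. Equality of mixed derivatives gives `dF ∧ b = 0`. If `n ≥ 2`, pick
`y ≠ 0` in the kernel of `b`; Euler's relation `dF(y) = F(y) > 0` then forces `b = 0`
(`eq_zero_of_hasFDerivAt`). If `n = 0` there is no index `k`.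

Conversely let `∇W = 0`. The horizontal vectors `(u, -Γ(u, y))` annihilate `⟨y, y⟩`, `⟨y, W⟩` and
`⟨W, W⟩`, hence the energy (`fderiv_localEnergy_horizontal`). Differentiating this identity in `y`
shows that `½ Γ(y, y)` satisfies the equation defining the spray (`spray_equation`). The fundamental
tensor is positive definite (`hessian_localEnergy_pos`), so the spray coefficients equal `½ Γ(y,
y)`, and their `y`-derivatives are the linear Levi-Civita coefficients. The Finslerian and
Riemannian translations then agree and `F` is Berwald; the natural translation agrees too, since
Riemannian translation is linear and carries `W` to `W`. -/

noncomputable section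

namespace Navigation

/-! ### Riemannian metrics on open sets of a vector space; the Koszul formula. -/

section LocalRiemannian

variable {E : Type*} [NormedAddCommGroup E] [NormedSpace ℝ E]

/-- A smooth Riemannian metric on an open subset of a vector space. -/
structure IsLocalMetric (H : E → E →L[ℝ] E →L[ℝ] ℝ) (U : Set E) : Prop where
  isOpen : IsOpen U
  smooth : ContDiffOn ℝ ∞ H U
  symm : ∀ x ∈ U, ∀ u v, H x u v = H x v u
  pos : ∀ x ∈ U, ∀ u, u ≠ 0 → 0 < H x u u

/-- `Γ` is the Levi-Civita connection of `H` at `x`, by the Koszul formula for constant vector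
fields. -/
def IsLeviCivitaAt (H : E → E →L[ℝ] E →L[ℝ] ℝ) (x : E) (Γ : E →L[ℝ] E →L[ℝ] E) : Prop :=
  ∀ u v z, 2 * H x (Γ u v) z = fderiv ℝ H x u v z + fderiv ℝ H x v u z - fderiv ℝ H x z u v

lemma hasFDerivAt_bilin_apply {E' : Type*} [NormedAddCommGroup E'] [NormedSpace ℝ E']
    {H : E' → E →L[ℝ] E →L[ℝ] ℝ} {x : E'} (hH : DifferentiableAt ℝ H x) (u v : E) :
    ∃ L : E' →L[ℝ] ℝ, HasFDerivAt (fun z => H z u v) L x ∧ ∀ a, L a = fderiv ℝ H x a u v := by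
  refine ⟨_, (hH.hasFDerivAt.clm_apply (hasFDerivAt_const u x)).clm_apply (hasFDerivAt_const v x),
    fun a => ?_⟩
  simp

namespace IsLocalMetric

variable {H : E → E →L[ℝ] E →L[ℝ] ℝ} {U : Set E} (hH : IsLocalMetric H U) {x : E} (hx : x ∈ U)
include hH hx

lemma contDiffAt : ContDiffAt ℝ ∞ H x := hH.smooth.contDiffAt (hH.isOpen.mem_nhds hx)

lemma differentiableAt : DifferentiableAt ℝ H x := (hH.contDiffAt hx).differentiableAt (by simp)

lemma nonneg (u : E) : 0 ≤ H x u u := by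
  rcases eq_or_ne u 0 with rfl | hu
  · simp
  · exact (hH.pos x hx u hu).le

lemma eq_zero {u : E} (hu : H x u u = 0) : u = 0 := by
  by_contra h
  exact (hH.pos x hx u h).ne' hu

lemma ext {u v : E} (h : ∀ z, H x u z = H x v z) : u = v := by
  rw [← sub_eq_zero]
  apply hH.eq_zero hx
  simpa [sub_eq_zero] using h (u - v)

lemma fderiv_symm (u v z : E) : fderiv ℝ H x u v z = fderiv ℝ H x u z v := by
  obtain ⟨L₁, h1, e1⟩ := hasFDerivAt_bilin_apply (hH.differentiableAt hx) v z
  obtain ⟨L₂, h2, e2⟩ := hasFDerivAt_bilin_apply (hH.differentiableAt hx) z v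
  have h3 := h1.congr_of_eventuallyEq (f₁ := fun y => H y z v) (by
    filter_upwards [hH.isOpen.mem_nhds hx] with y hy using hH.symm y hy z v)
  rw [← e1, ← e2, h3.unique h2]

variable {Γ : E →L[ℝ] E →L[ℝ] E}

lemma leviCivita_symm (hΓ : IsLeviCivitaAt H x Γ) (u v : E) : Γ u v = Γ v u := by
  apply hH.ext hx
  intro z
  have h1 := hΓ u v z
  have h2 := hΓ v u z
  have h3 := hH.fderiv_symm hx z u v
  linarith

lemma leviCivita_compat (hΓ : IsLeviCivitaAt H x Γ) (u v z : E) :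
    fderiv ℝ H x u v z = H x (Γ u v) z + H x v (Γ u z) := by
  have h1 := hΓ u v z
  have h2 := hΓ u z v
  have h3 := hH.fderiv_symm hx u v z
  have h4 := hH.fderiv_symm hx v u z
  have h5 := hH.fderiv_symm hx z u v
  have h6 := hH.symm x hx v (Γ u z)
  linarith

end IsLocalMetric

set_option synthInstance.maxHeartbeats 200000 in
/-- The transformation rule of the Christoffel symbols under an isometry `φ`. -/
lemma leviCivita_naturality {H₁ H₂ : E → E →L[ℝ] E →L[ℝ] ℝ} {U₁ U₂ : Set E} {φ : E → E} {x : E}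
    (hH₂ : IsLocalMetric H₂ U₂) (hx₁ : x ∈ U₁) (hU₁ : IsOpen U₁)
    (hx₂ : φ x ∈ U₂) (hφ : ContDiffAt ℝ ∞ φ x) (hφs : Function.Surjective (fderiv ℝ φ x))
    (hiso : ∀ y ∈ U₁, ∀ u v, H₁ y u v = H₂ (φ y) (fderiv ℝ φ y u) (fderiv ℝ φ y v))
    (hd₁ : DifferentiableAt ℝ H₁ x)
    {Γ₁ Γ₂ : E →L[ℝ] E →L[ℝ] E} (hΓ₁ : IsLeviCivitaAt H₁ x Γ₁)
    (hΓ₂ : IsLeviCivitaAt H₂ (φ x) Γ₂) (u v : E) :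
    fderiv ℝ φ x (Γ₁ u v) =
      Γ₂ (fderiv ℝ φ x u) (fderiv ℝ φ x v) + fderiv ℝ (fderiv ℝ φ) x u v := by
  set D := fderiv ℝ φ x with hD
  set D2 := fderiv ℝ (fderiv ℝ φ) x with hD2
  have hφ1 : HasFDerivAt φ D x := (hφ.differentiableAt (by simp)).hasFDerivAt
  have hφ2 : HasFDerivAt (fderiv ℝ φ) D2 x :=
    ((hφ.fderiv_right (m := 1) (by norm_cast)).differentiableAt (by simp)).hasFDerivAt
  have hsymm : ∀ a b, D2 a b = D2 b a := fun a b =>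
    (hφ.isSymmSndFDerivAt (by simp; norm_cast)) a b
  have hder : ∀ a b c, fderiv ℝ H₁ x a b c = fderiv ℝ H₂ (φ x) (D a) (D b) (D c)
      + H₂ (φ x) (D2 a b) (D c) + H₂ (φ x) (D b) (D2 a c) := by
    intro a b c
    obtain ⟨L, h1, e1⟩ := hasFDerivAt_bilin_apply hd₁ b c
    have h2 : HasFDerivAt (fun y => H₂ (φ y) (fderiv ℝ φ y b) (fderiv ℝ φ y c)) _ x :=
      (((hH₂.differentiableAt hx₂).hasFDerivAt.comp x hφ1).clm_apply
      (hφ2.clm_apply (hasFDerivAt_const b x))).clm_apply (hφ2.clm_apply (hasFDerivAt_const c x))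
    have h3 := h2.congr_of_eventuallyEq (f₁ := fun y => H₁ y b c) (by
      filter_upwards [hU₁.mem_nhds hx₁] with y hy using hiso y hy b c)
    have h4 := DFunLike.congr_fun (h1.unique h3) a
    rw [e1] at h4
    simp at h4
    rw [h4]
    ring
  -- In the Koszul combination of the differentiated isometry condition, symmetry of the second
  -- derivative cancels every second-order term except `2 H₂(D²φ(u, v), Dφ z)`.
  apply hH₂.ext hx₂
  intro z
  obtain ⟨z, rfl⟩ := hφs z
  have e1 := hΓ₁ u v z
  have e2 := hΓ₂ (D u) (D v) (D z)
  rw [hder, hder, hder, hsymm v u, hsymm z u, hsymm z v, hiso x hx₁] at e1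
  have e3 := hH₂.symm (φ x) hx₂ (D2 u z) (D v)
  simp only [map_add, add_apply, ← hD] at e1 e2 ⊢
  linarith

end LocalRiemannian

/-! ### The Randers norm as a scalar function of `‖y‖²`, `⟨y, W⟩` and `‖W‖²`. -/

section RandersFormula

/-- The Randers norm in terms of `α = ‖y‖²`, `β = ⟨y, W⟩` and `δ = ‖W‖²`. -/
def randersFormula (α β δ : ℝ) : ℝ := (Real.sqrt (β ^ 2 + (1 - δ) * α) - β) / (1 - δ)

variable {α β δ : ℝ}

lemma randersFormula_radicand_pos (hα : 0 < α) (hδ : δ < 1) : 0 < β ^ 2 + (1 - δ) * α := by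
  have := mul_pos (sub_pos.2 hδ) hα
  positivity

lemma randersFormula_linear (hδ : δ < 1) :
    (1 - δ) * randersFormula α β δ + β = Real.sqrt (β ^ 2 + (1 - δ) * α) := by
  have : 1 - δ ≠ 0 := (sub_pos.2 hδ).ne'
  rw [randersFormula]
  field_simp
  ring

lemma randersFormula_linear_pos (hα : 0 < α) (hδ : δ < 1) :
    0 < (1 - δ) * randersFormula α β δ + β := by
  rw [randersFormula_linear hδ]
  exact Real.sqrt_pos.2 (randersFormula_radicand_pos hα hδ)

/-- This is the navigation equation `‖y - F W‖² = F²` with the square expanded; it replaces the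
square root whenever `F` is differentiated. -/
lemma randersFormula_quadratic (hα : 0 < α) (hδ : δ < 1) :
    (1 - δ) * randersFormula α β δ ^ 2 + 2 * β * randersFormula α β δ = α := by
  have h0 : 0 < 1 - δ := sub_pos.2 hδ
  have h1 := randersFormula_linear (α := α) (β := β) hδ
  have h2 := Real.sq_sqrt (randersFormula_radicand_pos (β := β) hα hδ).le
  rw [← h1] at h2
  have h3 : (1 - δ) * ((1 - δ) * randersFormula α β δ ^ 2 + 2 * β * randersFormula α β δ)
      = (1 - δ) * α := by linarith
  exact mul_left_cancel₀ h0.ne' h3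

lemma randersFormula_pos (hα : 0 < α) (hδ : δ < 1) : 0 < randersFormula α β δ := by
  have h0 : 0 < 1 - δ := sub_pos.2 hδ
  rw [randersFormula]
  refine div_pos (sub_pos.2 ?_) h0
  refine lt_of_le_of_lt (le_abs_self β) ?_
  rw [← Real.sqrt_sq_eq_abs]
  apply Real.sqrt_lt_sqrt (sq_nonneg _)
  have := mul_pos h0 hα
  linarith

lemma randersFormula_homogeneous {t : ℝ} (ht : 0 ≤ t) :
    randersFormula (t ^ 2 * α) (t * β) δ = t * randersFormula α β δ := by
  have : (t * β) ^ 2 + (1 - δ) * (t ^ 2 * α) = t ^ 2 * (β ^ 2 + (1 - δ) * α) := by ring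
  rw [randersFormula, randersFormula, this, Real.sqrt_mul (sq_nonneg t), Real.sqrt_sq ht]
  ring

lemma contDiffAt_randersFormula {E : Type*} [NormedAddCommGroup E] [NormedSpace ℝ E]
    {a b c : E → ℝ} {x : E} {m : WithTop ℕ∞} (ha : ContDiffAt ℝ m a x) (hb : ContDiffAt ℝ m b x)
    (hc : ContDiffAt ℝ m c x) (hα : 0 < a x) (hδ : c x < 1) :
    ContDiffAt ℝ m (fun z => randersFormula (a z) (b z) (c z)) x := by
  unfold randersFormula
  refine ContDiffAt.div (ContDiffAt.sub (ContDiffAt.sqrt ?_ ?_) hb) ?_ (sub_pos.2 hδ).ne'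
  · exact (hb.pow 2).add ((contDiffAt_const.sub hc).mul ha)
  · exact (randersFormula_radicand_pos hα hδ).ne'
  · exact contDiffAt_const.sub hc

end RandersFormula

/-! ### Randers norms on open sets: convexity, spray, and the integrability argument. -/

section LocalRanders

open Filter Topology

variable {E : Type*} [NormedAddCommGroup E] [NormedSpace ℝ E]

/-- The Randers norm of the local navigation data `(H, w)`, as a function of `(x, y)`. -/
def localRanders (H : E → E →L[ℝ] E →L[ℝ] ℝ) (w : E → E) (z : E × E) : ℝ :=
  randersFormula (H z.1 z.2 z.2) (H z.1 z.2 (w z.1)) (H z.1 (w z.1) (w z.1))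

/-- The energy of the Randers norm of the local navigation data `(H, w)`. -/
def localEnergy (H : E → E →L[ℝ] E →L[ℝ] ℝ) (w : E → E) (z : E × E) : ℝ :=
  (1 / 2) * localRanders H w z ^ 2

/-- Smooth navigation data on an open subset of a vector space. -/
structure IsLocalNavigation (H : E → E →L[ℝ] E →L[ℝ] ℝ) (w : E → E) (U : Set E) : Prop
    extends IsLocalMetric H U where
  smooth_field : ContDiffOn ℝ ∞ w U
  norm_lt_one : ∀ x ∈ U, H x (w x) (w x) < 1

/-- Being `C^∞` at a point provides neighbourhoods that depend on the order, so a finite order has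
to be fixed first; two is enough here. -/
lemma eventually_contDiffAt {F : Type*} [NormedAddCommGroup F] [NormedSpace ℝ F] {g : E → F}
    {x : E} (hg : ContDiffAt ℝ ∞ g x) : ∀ᶠ y in 𝓝 x, ContDiffAt ℝ 2 g y :=
  (hg.of_le (m := 2) (by norm_cast)).eventually (by simp)

lemma differentiableAt_fderiv {F : Type*} [NormedAddCommGroup F] [NormedSpace ℝ F] {g : E → F}
    {x : E} (hg : ContDiffAt ℝ ∞ g x) : DifferentiableAt ℝ (fderiv ℝ g) x :=
  (hg.fderiv_right (m := 1) (by norm_cast)).differentiableAt (by simp)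

lemma hasFDerivAt_comp_fst {F : Type*} [NormedAddCommGroup F] [NormedSpace ℝ F] {g : E → F}
    {x : E} (hg : DifferentiableAt ℝ g x) (y : E) :
    HasFDerivAt (fun z : E × E => g z.1)
      ((fderiv ℝ g x).comp (ContinuousLinearMap.fst ℝ E E)) (x, y) := by
  have h : HasFDerivAt g (fderiv ℝ g x) (x, y).1 := hg.hasFDerivAt
  exact h.comp (x, y) hasFDerivAt_fst

lemma hasFDerivAt_mk_right (x y : E) :
    HasFDerivAt (fun z : E => (x, z)) (ContinuousLinearMap.inr ℝ E E) y :=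
  hasFDerivAt_prodMk_right x y

lemma hasFDerivAt_fderiv_mk_right {g : E × E → ℝ} {x y : E} (hg : ContDiffAt ℝ ∞ g (x, y)) :
    HasFDerivAt (fun z => fderiv ℝ g (x, z))
      ((fderiv ℝ (fderiv ℝ g) (x, y)).comp (ContinuousLinearMap.inr ℝ E E)) y :=
  (differentiableAt_fderiv hg).hasFDerivAt.comp y (hasFDerivAt_mk_right x y)

lemma hasDerivAt_vertical_line {g : E × E → ℝ} {x y u : E} {s : ℝ}
    (hg : DifferentiableAt ℝ g (x, y + s • u)) :
    HasDerivAt (fun s : ℝ => g (x, y + s • u)) (fderiv ℝ g (x, y + s • u) (0, u)) s := by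
  have h1 : HasDerivAt (fun s : ℝ => (x, y + s • u)) (0, u) s := by
    have := (hasDerivAt_const s x).prodMk (((hasDerivAt_id s).smul_const u).const_add y)
    simpa using this
  exact hg.hasFDerivAt.comp_hasDerivAt s h1

lemma hasDerivAt_vertical_line_fderiv {g : E × E → ℝ} {x y u : E}
    (hg : ContDiffAt ℝ ∞ g (x, y)) :
    HasDerivAt (fun s : ℝ => fderiv ℝ g (x, y + s • u) (0, u))
      (fderiv ℝ (fderiv ℝ g) (x, y) (0, u) (0, u)) 0 := by
  have h1 : HasDerivAt (fun s : ℝ => (x, y + s • u)) (0, u) 0 := by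
    have := (hasDerivAt_const (0 : ℝ) x).prodMk
      (((hasDerivAt_id (0 : ℝ)).smul_const u).const_add y)
    simpa using this
  have h2 : HasFDerivAt (fderiv ℝ g) (fderiv ℝ (fderiv ℝ g) (x, y))
      ((fun s : ℝ => (x, y + s • u)) 0) := by
    simpa using (differentiableAt_fderiv hg).hasFDerivAt
  have h3 := (h2.clm_apply (hasFDerivAt_const ((0 : E), u) _)).comp_hasDerivAt 0 h1
  refine h3.congr_deriv ?_
  simp

lemma eventually_vertical_line {P : E × E → Prop} {x y u : E} (h : ∀ᶠ z in 𝓝 (x, y), P z) :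
    ∀ᶠ s in 𝓝 (0 : ℝ), P (x, y + s • u) := by
  have : Continuous fun s : ℝ => (x, y + s • u) := by fun_prop
  exact (this.tendsto' 0 (x, y) (by simp)).eventually h

namespace IsLocalNavigation

variable {H : E → E →L[ℝ] E →L[ℝ] ℝ} {w : E → E} {U : Set E} (hN : IsLocalNavigation H w U)
include hN

section Pointwise

variable {x y : E} (hx : x ∈ U) (hy : y ≠ 0)
include hx

lemma contDiffAt_field : ContDiffAt ℝ ∞ w x := hN.smooth_field.contDiffAt (hN.isOpen.mem_nhds hx)

omit hN hx in
lemma localRanders_smul {t : ℝ} (ht : 0 ≤ t) :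
    localRanders H w (x, t • y) = t * localRanders H w (x, y) := by
  rw [localRanders, localRanders, ← randersFormula_homogeneous ht]
  congr 1
  · simp; ring
  · simp

include hy

lemma contDiffAt_localRanders : ContDiffAt ℝ ∞ (localRanders H w) (x, y) := by
  have hH : ContDiffAt ℝ ∞ (fun z : E × E => H z.1) (x, y) :=
    (hN.contDiffAt hx).comp (x, y) contDiffAt_fst
  have hw : ContDiffAt ℝ ∞ (fun z : E × E => w z.1) (x, y) :=
    (hN.contDiffAt_field hx).comp (x, y) contDiffAt_fst
  exact contDiffAt_randersFormula ((hH.clm_apply contDiffAt_snd).clm_apply contDiffAt_snd)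
    ((hH.clm_apply contDiffAt_snd).clm_apply hw) ((hH.clm_apply hw).clm_apply hw)
    (hN.pos x hx y hy) (hN.norm_lt_one x hx)

lemma contDiffAt_localEnergy : ContDiffAt ℝ ∞ (localEnergy H w) (x, y) :=
  contDiffAt_const.mul ((hN.contDiffAt_localRanders hx hy).pow 2)

lemma localRanders_pos : 0 < localRanders H w (x, y) :=
  randersFormula_pos (hN.pos x hx y hy) (hN.norm_lt_one x hx)

/-- Euler's relation for the Randers norm. -/
lemma fderiv_localRanders_self :
    fderiv ℝ (localRanders H w) (x, y) (0, y) = localRanders H w (x, y) := by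
  have h1 := hasDerivAt_vertical_line (g := localRanders H w) (x := x) (y := y) (u := y) (s := 0)
    (by simpa using (hN.contDiffAt_localRanders hx hy).differentiableAt (by simp))
  have h2 : HasDerivAt (fun s : ℝ => (1 + s) * localRanders H w (x, y))
      (localRanders H w (x, y)) 0 := by
    simpa using ((hasDerivAt_id (0 : ℝ)).const_add 1).mul_const (localRanders H w (x, y))
  have h3 := h2.congr_of_eventuallyEq (f₁ := fun s : ℝ => localRanders H w (x, y + s • y)) (by
    -- Homogeneity holds for nonnegative factors only, hence `1 + s` is kept positive.
    filter_upwards [lt_mem_nhds (show (-1 : ℝ) < 0 by norm_num)] with s hs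
    rw [← localRanders_smul (by linarith), add_smul, one_smul])
  simpa using h1.unique h3

/-- The fundamental tensor of the Randers norm is positive definite. -/
lemma hessian_localEnergy_pos {u : E} (hu : u ≠ 0) :
    0 < fderiv ℝ (fderiv ℝ (localEnergy H w)) (x, y) (0, u) (0, u) := by
  have hR := hN.contDiffAt_localRanders hx hy
  have hE := hN.contDiffAt_localEnergy hx hy
  set f : ℝ → ℝ := fun s => localRanders H w (x, y + s • u) with hf
  set f1 : ℝ → ℝ := fun s => fderiv ℝ (localRanders H w) (x, y + s • u) (0, u) with hf1
  set f2 := fderiv ℝ (fderiv ℝ (localRanders H w)) (x, y) (0, u) (0, u) with hf2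
  set e2 := fderiv ℝ (fderiv ℝ (localEnergy H w)) (x, y) (0, u) (0, u) with he2
  have d1 : ∀ᶠ s in 𝓝 (0 : ℝ), HasDerivAt f (f1 s) s := by
    filter_upwards [eventually_vertical_line (u := u) (eventually_contDiffAt hR)] with s hs
    exact hasDerivAt_vertical_line (hs.differentiableAt (by simp))
  have d2 : HasDerivAt f1 f2 0 := hasDerivAt_vertical_line_fderiv hR
  have de : ∀ᶠ s in 𝓝 (0 : ℝ),
      fderiv ℝ (localEnergy H w) (x, y + s • u) (0, u) = f s * f1 s := by
    filter_upwards [d1, eventually_vertical_line (u := u) (eventually_contDiffAt hE)] with s hs hs'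
    have h1 := hasDerivAt_vertical_line (u := u) (hs'.differentiableAt (by simp))
    have h2 := (hs.pow 2).const_mul (1 / 2 : ℝ)
    rw [h1.unique h2]
    simp
    ring
  -- As `E = F²/2`, one has `E'' = F'² + F F''` along the line, so it suffices to show `F'' ≥ 0`,
  -- and `F'' > 0` where `F' = 0`. Both follow by differentiating the quadratic equation for `F`
  -- twice (`q0`, `q1`, `q2`).
  have e0 : e2 = f1 0 ^ 2 + f 0 * f2 := by
    have h1 : HasDerivAt (fun s : ℝ => fderiv ℝ (localEnergy H w) (x, y + s • u) (0, u)) e2 0 :=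
      hasDerivAt_vertical_line_fderiv (u := u) hE
    have h2 := (d1.self_of_nhds.mul d2).congr_of_eventuallyEq de
    rw [h1.unique h2]
    ring
  have hy' : ∀ᶠ s in 𝓝 (0 : ℝ), y + s • u ≠ 0 :=
    eventually_vertical_line (P := fun z => z.2 ≠ 0) (x := x)
      ((isOpen_ne_fun continuous_snd continuous_const).mem_nhds hy)
  set δ := H x (w x) (w x) with hδ
  have hδ1 : δ < 1 := hN.norm_lt_one x hx
  set α0 := H x y y with hα0
  set α1 := H x y u with hα1
  set α2 := H x u u with hα2
  set β0 := H x y (w x) with hβ0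
  set β1 := H x u (w x) with hβ1
  have sα : H x u y = α1 := hN.symm x hx u y
  have sβ0 : H x (w x) y = β0 := hN.symm x hx _ _
  have sβ1 : H x (w x) u = β1 := hN.symm x hx _ _
  have q0 : ∀ᶠ s in 𝓝 (0 : ℝ), (1 - δ) * f s ^ 2 + 2 * (β0 + s * β1) * f s
      = α0 + 2 * s * α1 + s ^ 2 * α2 := by
    filter_upwards [hy'] with s hs
    have h1 := randersFormula_quadratic (β := H x (y + s • u) (w x)) (hN.pos x hx _ hs) hδ1
    have h2 : H x (y + s • u) (w x) = β0 + s * β1 := by simp [hβ0, hβ1]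
    have h3 : H x (y + s • u) (y + s • u) = α0 + 2 * s * α1 + s ^ 2 * α2 := by
      simp only [map_add, add_apply, map_smul, smul_apply, smul_eq_mul, sα]
      ring
    rw [← h2, ← h3]
    exact h1
  have q1 : ∀ᶠ s in 𝓝 (0 : ℝ), (1 - δ) * (f s * f1 s) + β1 * f s + (β0 + s * β1) * f1 s
      = α1 + s * α2 := by
    filter_upwards [q0.eventually_nhds, d1] with s hs hd
    have hl : HasDerivAt (fun s => β0 + s * β1) β1 s := by
      simpa using ((hasDerivAt_id s).mul_const β1).const_add β0
    have h1 := ((hd.pow 2).const_mul (1 - δ)).add ((hl.const_mul 2).mul hd)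
    have h2 : HasDerivAt (fun s => α0 + 2 * s * α1 + s ^ 2 * α2) (2 * α1 + 2 * s * α2) s := by
      have := ((((hasDerivAt_id s).const_mul 2).mul_const α1).const_add α0).add
        (((hasDerivAt_id s).pow 2).mul_const α2)
      refine this.congr_deriv ?_
      simp
    have h3 := h1.unique (h2.congr_of_eventuallyEq hs)
    simp at h3
    linarith
  have q2 : (1 - δ) * (f1 0 ^ 2 + f 0 * f2) + 2 * β1 * f1 0 + β0 * f2 = α2 := by
    have hd := d1.self_of_nhds
    have hl : HasDerivAt (fun s => β0 + s * β1) β1 0 := by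
      simpa using ((hasDerivAt_id (0 : ℝ)).mul_const β1).const_add β0
    have hr : HasDerivAt (fun s => α1 + s * α2) α2 0 := by
      simpa using ((hasDerivAt_id (0 : ℝ)).mul_const α2).const_add α1
    have h1 := (((hd.mul d2).const_mul (1 - δ)).add (hd.const_mul β1)).add (hl.mul d2)
    have h3 := h1.unique (hr.congr_of_eventuallyEq q1)
    simp at h3
    linarith
  have p0 := q0.self_of_nhds
  have p1 := q1.self_of_nhds
  have hfpos : 0 < f 0 := by
    simpa [hf] using hN.localRanders_pos hx hy
  have hS : 0 < (1 - δ) * f 0 + β0 := by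
    have := randersFormula_linear_pos (β := β0) (hN.pos x hx y hy) hδ1
    simpa [hf, localRanders] using this
  have hα2pos : 0 < α2 := hN.pos x hx u hu
  generalize f 0 = a at *
  generalize f1 0 = b at *
  -- With `a = F` and `b = F'`, the relations `p0` and `p1` say `‖y - aW‖² = a²` and `⟨u - bW, y -
  -- aW⟩ = ab`, while `q2` says `((1 - δ) a + β0) F'' = ‖u - bW‖² - b²`. Multiplied by `a²`, the
  -- last right-hand side is the squared norm of the vector chosen here, as in the proof of
  -- Cauchy–Schwarz.
  have cs := hN.nonneg hx (a • (u - b • w x) - b • (y - a • w x))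
  simp only [map_sub, map_smul, sub_apply, smul_apply, smul_eq_mul, sα, sβ0, sβ1, ← hα0, ← hα1,
    ← hα2, ← hβ0, ← hβ1, ← hδ] at cs
  have hQ : 0 ≤ a ^ 2 * (((1 - δ) * a + β0) * f2) := by
    have : a ^ 2 * (((1 - δ) * a + β0) * f2) = a ^ 2 * (α2 - 2 * b * β1 + b ^ 2 * δ)
        - 2 * a * b * (α1 - b * β0 - a * β1 + a * b * δ)
        + b ^ 2 * (α0 - 2 * a * β0 + a ^ 2 * δ) := by
      linear_combination a ^ 2 * q2 - 2 * a * b * p1 + b ^ 2 * p0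
    rw [this]
    linarith
  have hf2 : 0 ≤ f2 := by
    have := nonneg_of_mul_nonneg_right hQ (by positivity)
    exact nonneg_of_mul_nonneg_right this hS
  rw [e0]
  rcases eq_or_ne b 0 with rfl | hb
  · rcases hf2.eq_or_lt with h | h
    · rw [← h] at q2
      simp at q2
      linarith
    · positivity
  · have := mul_nonneg hfpos.le hf2
    positivity

lemma hessian_localEnergy_symm (a b : E × E) :
    fderiv ℝ (fderiv ℝ (localEnergy H w)) (x, y) a b
      = fderiv ℝ (fderiv ℝ (localEnergy H w)) (x, y) b a :=
  (hN.contDiffAt_localEnergy hx hy).isSymmSndFDerivAt (by simp; norm_cast) a b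

set_option synthInstance.maxHeartbeats 200000 in
/-- If `w` is parallel, then the energy is constant along horizontal vectors. -/
lemma fderiv_localEnergy_horizontal {Γ : E →L[ℝ] E →L[ℝ] E} (hΓ : IsLeviCivitaAt H x Γ)
    (hw : ∀ u, fderiv ℝ w x u + Γ u (w x) = 0) (u : E) :
    fderiv ℝ (localEnergy H w) (x, y) (u, -Γ u y) = 0 := by
  have hH := hasFDerivAt_comp_fst (F := E →L[ℝ] E →L[ℝ] ℝ) (hN.differentiableAt hx) y
  have hwd : HasFDerivAt (fun z : E × E => w z.1)
      ((fderiv ℝ w x).comp (ContinuousLinearMap.fst ℝ E E)) (x, y) :=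
    hasFDerivAt_comp_fst ((hN.contDiffAt_field hx).differentiableAt (by simp)) y
  have ha := (hH.clm_apply hasFDerivAt_snd).clm_apply hasFDerivAt_snd
  have hb := (hH.clm_apply hasFDerivAt_snd).clm_apply hwd
  have hc := (hH.clm_apply hwd).clm_apply hwd
  have hΦ : DifferentiableAt ℝ (fun p : ℝ × ℝ × ℝ => (1 / 2) * randersFormula p.1 p.2.1 p.2.2 ^ 2)
      (H x y y, H x y (w x), H x (w x) (w x)) := by
    refine ContDiffAt.differentiableAt (n := 1) ?_ (by simp)
    refine contDiffAt_const.mul (ContDiffAt.pow ?_ 2)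
    exact contDiffAt_randersFormula contDiffAt_fst contDiffAt_snd.fst contDiffAt_snd.snd
      (hN.pos x hx y hy) (hN.norm_lt_one x hx)
  have key := hΦ.hasFDerivAt.comp (x, y) (ha.prodMk (hb.prodMk hc))
  have hE : HasFDerivAt (localEnergy H w) _ (x, y) := key
  have hw' : fderiv ℝ w x u = -Γ u (w x) := eq_neg_of_add_eq_zero_left (hw u)
  -- By the chain rule it is enough that the three inner products have zero derivative in the
  -- horizontal direction. Both `y` and `w` change by `-Γ u`, so this is metric compatibility.
  rw [hE.fderiv, ContinuousLinearMap.comp_apply]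
  refine (DFunLike.congr_arg _ ?_).trans (map_zero _)
  have c := hN.leviCivita_compat hx hΓ u
  simp [Prod.ext_iff, hw', c]

end Pointwise

/-- If `w` is parallel, then the spray of the Randers norm is that of the Riemannian metric. -/
lemma spray_equation {x y : E} (hx : x ∈ U) (hy : y ≠ 0) {Γ : E →L[ℝ] E →L[ℝ] E}
    (hΓ : IsLeviCivitaAt H x Γ) (hw : ∀ u, fderiv ℝ w x u + Γ u (w x) = 0) (v : E) :
    fderiv ℝ (fderiv ℝ (localEnergy H w)) (x, y) (y, 0) (0, v)
      - fderiv ℝ (localEnergy H w) (x, y) (v, 0)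
      = fderiv ℝ (fderiv ℝ (localEnergy H w)) (x, y) (0, Γ y y) (0, v) := by
  have hz : ∀ z, z ≠ 0 → ∀ u, fderiv ℝ (localEnergy H w) (x, z) (u, 0)
      = fderiv ℝ (localEnergy H w) (x, z) (0, Γ u z) := by
    intro z hz u
    have h1 := hN.fderiv_localEnergy_horizontal hx hz hΓ hw u
    have h2 : (u, -Γ u z) = (u, (0 : E)) - (0, Γ u z) := by simp
    rw [h2, map_sub, sub_eq_zero] at h1
    exact h1
  have hE := hasFDerivAt_fderiv_mk_right (hN.contDiffAt_localEnergy hx hy)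
  have h1 := hE.clm_apply (hasFDerivAt_const (y, (0 : E)) y)
  -- The horizontal direction is frozen at `y` while only the fibre point `z` varies. The extra
  -- first-order term `dE(0, Γ y v)` is cancelled by the identity at `y` in direction `v`, by
  -- symmetry of `Γ`.
  have h2 := hE.clm_apply ((hasFDerivAt_mk_right (0 : E) _).comp y (Γ y).hasFDerivAt)
  have h3 := h2.congr_of_eventuallyEq
    (f₁ := fun z => fderiv ℝ (localEnergy H w) (x, z) (y, 0)) (by
      filter_upwards [isOpen_ne.mem_nhds hy] with z hz' using hz z hz' y)
  have h4 := DFunLike.congr_fun (h1.unique h3) v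
  simp at h4
  rw [hN.hessian_localEnergy_symm hx hy (y, 0), hN.hessian_localEnergy_symm hx hy (0, Γ y y),
    h4, hz y hy v, hN.leviCivita_symm hx hΓ v y]
  ring

/-- A one-form `b` for which `γ - F b` is a vertical gradient has to vanish. -/
lemma eq_zero_of_hasFDerivAt {x : E} (hx : x ∈ U) (hdim : ∀ b : E →L[ℝ] ℝ, ∃ y, y ≠ 0 ∧ b y = 0)
    {G : E → ℝ} {γ : E →L[ℝ] E →L[ℝ] ℝ} (hγ : ∀ u v, γ u v = γ v u) {b : E →L[ℝ] ℝ}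
    (hG : ∀ y, y ≠ 0 → HasFDerivAt G (γ y - localRanders H w (x, y) • b) y) : b = 0 := by
  obtain ⟨y, hy, hb⟩ := hdim b
  have hF : HasFDerivAt (fun z => localRanders H w (x, z)) _ y :=
    ((hN.contDiffAt_localRanders hx hy).differentiableAt (by simp)).hasFDerivAt.comp y
      (hasFDerivAt_mk_right x y)
  have h2 := γ.hasFDerivAt.sub (hF.smul_const b)
  have h3 := second_derivative_symmetric_of_eventually
    (by filter_upwards [isOpen_ne.mem_nhds hy] with z hz using hG z hz) h2
  ext v
  -- Symmetry in the directions `y` and `v` reads `dF(y) b(v) = dF(v) b(y)`, and the right-hand side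
  -- vanishes by the choice of `y`.
  have h4 := h3 y v
  simp [hγ y v, hb] at h4
  rw [hN.fderiv_localRanders_self hx hy] at h4
  rcases h4 with h4 | h4
  · exact absurd h4 (hN.localRanders_pos hx hy).ne'
  · simpa using h4

end IsLocalNavigation

end LocalRanders

/-! ### Partial derivatives, Gram matrices and their inverses. -/

section Coordinates

variable {n : ℕ}

lemma coord_eq_sum (y : Coord n) : y = ∑ i, y i • EuclideanSpace.single i (1 : ℝ) := by
  ext k
  simp [Finset.sum_apply, Pi.single_apply]

lemma clm_apply_eq_sum (L : Coord n →L[ℝ] ℝ) (y : Coord n) :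
    L y = ∑ i, L (EuclideanSpace.single i 1) * y i := by
  conv_lhs => rw [coord_eq_sum y]
  simp [mul_comm]

lemma isLinearMap_eq_zero {f : Coord n → ℝ} (hf : IsLinearMap ℝ f)
    (h : ∀ i, f (EuclideanSpace.single i 1) = 0) (y : Coord n) : f y = 0 := by
  have := clm_apply_eq_sum (hf.mk' f).toContinuousLinearMap y
  simpa [h] using this

lemma partialDeriv_eq {f : Coord n → ℝ} {L : Coord n →L[ℝ] ℝ} {x : Coord n}
    (h : HasFDerivAt f L x) (i : Fin n) : partialDeriv i f x = L (EuclideanSpace.single i 1) := by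
  rw [partialDeriv, h.fderiv]

/-- The matrix of a bilinear form. -/
def bilinMatrix (B : Coord n →L[ℝ] Coord n →L[ℝ] ℝ) : Matrix (Fin n) (Fin n) ℝ :=
  Matrix.of fun i j => B (EuclideanSpace.single i 1) (EuclideanSpace.single j 1)

lemma bilinMatrix_sum (B : Coord n →L[ℝ] Coord n →L[ℝ] ℝ) (i : Fin n) (v : Coord n) :
    ∑ j, bilinMatrix B i j * v j = B (EuclideanSpace.single i 1) v :=
  (clm_apply_eq_sum (B (EuclideanSpace.single i 1)) v).symm

/-- A kernel vector `v` of the matrix would satisfy `B v v = 0`. -/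
lemma det_bilinMatrix_ne_zero {B : Coord n →L[ℝ] Coord n →L[ℝ] ℝ}
    (hB : ∀ u, u ≠ 0 → 0 < B u u) : (bilinMatrix B).det ≠ 0 := by
  intro h
  obtain ⟨v, hv, hBv⟩ := Matrix.exists_mulVec_eq_zero_iff.2 h
  have hv' : WithLp.toLp 2 v ≠ (0 : Coord n) := by simpa using hv
  refine (hB _ hv').ne' ?_
  have h1 := clm_apply_eq_sum (B.flip (WithLp.toLp 2 v)) (WithLp.toLp 2 v)
  simp only [ContinuousLinearMap.flip_apply] at h1
  rw [h1]
  refine Finset.sum_eq_zero fun i _ => ?_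
  rw [← bilinMatrix_sum]
  have := congrFun hBv i
  simp only [Matrix.mulVec, dotProduct, Pi.zero_apply] at this
  simp [this]

/-- Solving a linear system with the inverse of the matrix of a bilinear form. -/
lemma bilinMatrix_inv_spec {B : Coord n →L[ℝ] Coord n →L[ℝ] ℝ}
    (hB : ∀ u, u ≠ 0 → 0 < B u u) {b : Fin n → ℝ} {v : Coord n}
    (hv : ∀ k, v k = ∑ l, (bilinMatrix B)⁻¹ k l * b l) (l : Fin n) :
    B (EuclideanSpace.single l 1) v = b l := by
  have hdet : IsUnit (bilinMatrix B).det := (det_bilinMatrix_ne_zero hB).isUnit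
  have h1 : (fun k => v k) = (bilinMatrix B)⁻¹.mulVec b := funext hv
  have h2 : (bilinMatrix B).mulVec (fun k => v k) = b := by
    rw [h1, Matrix.mulVec_mulVec, Matrix.mul_nonsing_inv _ hdet, Matrix.one_mulVec]
  rw [← bilinMatrix_sum]
  exact congrFun h2 l

lemma bilinMatrix_inv_unique {B : Coord n →L[ℝ] Coord n →L[ℝ] ℝ}
    (hB : ∀ u, u ≠ 0 → 0 < B u u) {b : Fin n → ℝ} {v : Coord n}
    (hv : ∀ l, B (EuclideanSpace.single l 1) v = b l) (k : Fin n) :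
    ∑ l, (bilinMatrix B)⁻¹ k l * b l = v k := by
  have hdet : IsUnit (bilinMatrix B).det := (det_bilinMatrix_ne_zero hB).isUnit
  have h1 : (bilinMatrix B).mulVec (fun k => v k) = b := by
    funext l
    exact (bilinMatrix_sum B l v).trans (hv l)
  have h2 : (bilinMatrix B)⁻¹.mulVec b = fun k => v k := by
    rw [← h1, Matrix.mulVec_mulVec, Matrix.nonsing_inv_mul _ hdet, Matrix.one_mulVec]
  exact congrFun h2 k

section MatrixInverse

variable {E : Type*} [NormedAddCommGroup E] [NormedSpace ℝ E]
  {A : E → Matrix (Fin n) (Fin n) ℝ} {x : E} {m : WithTop ℕ∞}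

lemma contDiffAt_matrix_det (hA : ∀ i j, ContDiffAt ℝ m (fun z => A z i j) x) :
    ContDiffAt ℝ m (fun z => (A z).det) x := by
  simp only [Matrix.det_apply']
  exact ContDiffAt.sum fun σ _ => contDiffAt_const.mul (contDiffAt_prod fun i _ => hA _ _)

/-- By Cramer's rule the entries of the inverse are quotients of determinants, that is, rational
functions of the entries of `A`. -/
lemma contDiffAt_matrix_inv (hA : ∀ i j, ContDiffAt ℝ m (fun z => A z i j) x)
    (hdet : (A x).det ≠ 0) (k l : Fin n) : ContDiffAt ℝ m (fun z => (A z)⁻¹ k l) x := by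
  simp only [Matrix.inv_def, Matrix.smul_apply, smul_eq_mul, Ring.inverse_eq_inv']
  refine ((contDiffAt_matrix_det hA).inv hdet).mul ?_
  simp only [Matrix.adjugate_apply]
  refine contDiffAt_matrix_det fun i j => ?_
  simp only [Matrix.updateRow_apply]
  split_ifs
  · exact contDiffAt_const
  · exact hA i j

end MatrixInverse

lemma hasDerivWithinAt_coord {f : ℝ → Coord n} {f' : Coord n} {s : Set ℝ} {t : ℝ} :
    HasDerivWithinAt f f' s t ↔ ∀ k, HasDerivWithinAt (fun z => f z k) (f' k) s t := by
  rw [hasDerivWithinAt_iff_hasFDerivWithinAt, hasFDerivWithinAt_euclidean]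
  refine forall_congr' fun k => ?_
  rw [hasDerivWithinAt_iff_hasFDerivWithinAt]
  refine iff_of_eq ?_
  congr 1

end Coordinates

/-! ### The metric, the field and the Randers norm read in a chart. -/

section Charts

variable {n : ℕ} {M : Type*} [TopologicalSpace M] [ChartedSpace (Coord n) M]
  [IsManifold (𝓡 n) ∞ M]

/-- The metric `h` in the chart at `p`. -/
def chartMetric (h : Metric n M) (p : M) (x : Coord n) : Coord n →L[ℝ] Coord n →L[ℝ] ℝ :=
  (ContinuousLinearMap.precomp ℝ
    ((trivializationAt (Coord n) (TangentSpace (𝓡 n) : M → Type _) p).symmL ℝ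
      (chartPoint p x))).comp ((h.inner (chartPoint p x)).comp
    ((trivializationAt (Coord n) (TangentSpace (𝓡 n) : M → Type _) p).symmL ℝ (chartPoint p x)))

/-- The vector field `W` in the chart at `p`. -/
def chartField (W : ∀ x : M, TangentSpace (𝓡 n) x) (p : M) (x : Coord n) : Coord n :=
  vectorCoord p (chartPoint p x) (W (chartPoint p x))

lemma chartMetric_apply (h : Metric n M) (p : M) (x u v : Coord n) :
    chartMetric h p x u v = h.inner (chartPoint p x) (chartVector p x u) (chartVector p x v) := rfl

lemma metricMatrix_eq (h : Metric n M) (p : M) (x : Coord n) :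
    metricMatrix h p x = bilinMatrix (chartMetric h p x) := rfl

section Basic

variable {p : M}

omit [IsManifold (𝓡 n) ∞ M] in
lemma chartPoint_mem {x : Coord n} (hx : x ∈ (extChartAt (𝓡 n) p).target) :
    chartPoint p x ∈ (chartAt (Coord n) p).source := by
  rw [← extChartAt_source (𝓡 n)]
  exact (extChartAt (𝓡 n) p).map_target hx

lemma vectorCoord_chartVector {x : Coord n} (hx : x ∈ (extChartAt (𝓡 n) p).target)
    (y : Coord n) : vectorCoord p (chartPoint p x) (chartVector p x y) = y :=
  Bundle.Trivialization.continuousLinearMapAt_symmL _ (chartPoint_mem hx) y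

lemma chartVector_vectorCoord {x : Coord n} (hx : x ∈ (extChartAt (𝓡 n) p).target)
    (v : TangentSpace (𝓡 n) (chartPoint p x)) :
    chartVector p x (vectorCoord p (chartPoint p x) v) = v :=
  Bundle.Trivialization.symmL_continuousLinearMapAt _ (chartPoint_mem hx) v

omit [IsManifold (𝓡 n) ∞ M] in
lemma chartPoint_extChartAt {q : M} (hq : q ∈ (chartAt (Coord n) p).source) :
    chartPoint p (extChartAt (𝓡 n) p q) = q :=
  (extChartAt (𝓡 n) p).left_inv (by rwa [extChartAt_source])

omit [IsManifold (𝓡 n) ∞ M] in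
lemma extChartAt_chartPoint {x : Coord n} (hx : x ∈ (extChartAt (𝓡 n) p).target) :
    extChartAt (𝓡 n) p (chartPoint p x) = x :=
  (extChartAt (𝓡 n) p).right_inv hx

omit [IsManifold (𝓡 n) ∞ M] in
lemma extChartAt_mem_target {q : M} (hq : q ∈ (chartAt (Coord n) p).source) :
    extChartAt (𝓡 n) p q ∈ (extChartAt (𝓡 n) p).target :=
  (extChartAt (𝓡 n) p).map_source (by rwa [extChartAt_source])

lemma vectorCoord_add (q : M) (v w : TangentSpace (𝓡 n) q) :
    vectorCoord p q (v + w) = vectorCoord p q v + vectorCoord p q w := map_add _ _ _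

lemma vectorCoord_smul (q : M) (a : ℝ) (v : TangentSpace (𝓡 n) q) :
    vectorCoord p q (a • v) = a • vectorCoord p q v := map_smul _ _ _

lemma chartVector_ne_zero {x : Coord n} (hx : x ∈ (extChartAt (𝓡 n) p).target) {y : Coord n}
    (hy : y ≠ 0) : chartVector p x y ≠ 0 := by
  intro h0
  apply hy
  rw [← vectorCoord_chartVector hx y, h0]
  exact map_zero _

lemma vectorCoord_ne_zero {q : M} (hq : q ∈ (chartAt (Coord n) p).source)
    {v : TangentSpace (𝓡 n) q} (hv : v ≠ 0) : vectorCoord p q v ≠ 0 := by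
  intro h0
  apply hv
  have h1 : (trivializationAt (Coord n) (TangentSpace (𝓡 n) : M → Type _) p).symmL ℝ q
      (vectorCoord p q v) = v :=
    Bundle.Trivialization.symmL_continuousLinearMapAt _ hq v
  rw [← h1, h0]
  exact map_zero _

/-- The metric of tangent vectors in terms of the coordinates in the chart at `p`. -/
lemma chartMetric_vectorCoord (h : Metric n M) {q : M} (hq : q ∈ (chartAt (Coord n) p).source)
    (v w : TangentSpace (𝓡 n) q) :
    chartMetric h p (extChartAt (𝓡 n) p q) (vectorCoord p q v) (vectorCoord p q w)
      = h.inner q v w := by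
  -- The base point of `chartMetric` equals `q` only propositionally, and tangent spaces depend on
  -- it; a free `q'` makes substitution possible.
  have key : ∀ q' : M, q' = q →
      h.inner q' ((trivializationAt (Coord n) (TangentSpace (𝓡 n) : M → Type _) p).symmL ℝ q'
        (vectorCoord p q v)) ((trivializationAt (Coord n) (TangentSpace (𝓡 n) : M → Type _)
          p).symmL ℝ q' (vectorCoord p q w)) = h.inner q v w := by
    rintro q' rfl
    have e : ∀ v : TangentSpace (𝓡 n) q',
        (trivializationAt (Coord n) (TangentSpace (𝓡 n) : M → Type _) p).symmL ℝ q'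
          (vectorCoord p q' v) = v :=
      fun v => Bundle.Trivialization.symmL_continuousLinearMapAt _ hq v
    rw [e, e]
  exact key _ (chartPoint_extChartAt hq)

end Basic

/-- In the trivialization at `p` this section has the constant fibre coordinate `u`. -/
lemma contMDiffOn_chart_section (p : M) (u : Coord n) :
    ContMDiffOn (𝓡 n) (𝓡 n).tangent ∞ (fun q : M => (⟨q, (trivializationAt (Coord n)
      (TangentSpace (𝓡 n) : M → Type _) p).symmL ℝ q u⟩ : TangentBundle (𝓡 n) M))
      (chartAt (Coord n) p).source := by
  have := ((trivializationAt (Coord n) (TangentSpace (𝓡 n) : M → Type _)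
    p).contMDiffOn_section_baseSet_iff (IB := 𝓡 n) (n := ∞) (s := fun q => (trivializationAt
      (Coord n) (TangentSpace (𝓡 n) : M → Type _) p).symmL ℝ q u)).2 (by
    refine (contMDiffOn_const (c := u)).congr fun q hq => ?_
    have h1 := Bundle.Trivialization.continuousLinearMapAt_symmL (R := ℝ)
      (trivializationAt (Coord n) (TangentSpace (𝓡 n) : M → Type _) p) hq u
    rw [Bundle.Trivialization.continuousLinearMapAt_apply_of_mem _ _ hq] at h1
    exact h1)
  exact this

lemma contMDiffOn_metric_chart (h : Metric n M) (p : M) (u v : Coord n) :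
    ContMDiffOn (𝓡 n) 𝓘(ℝ, ℝ) ∞ (fun q : M => h.inner q
      ((trivializationAt (Coord n) (TangentSpace (𝓡 n) : M → Type _) p).symmL ℝ q u)
      ((trivializationAt (Coord n) (TangentSpace (𝓡 n) : M → Type _) p).symmL ℝ q v))
      (chartAt (Coord n) p).source := by
  intro q hq
  have : ContMDiffWithinAt (𝓡 n) ((𝓡 n).prod 𝓘(ℝ)) ∞
      (fun q : M => Bundle.TotalSpace.mk' ℝ (E := Bundle.Trivial M ℝ) q (h.inner q
        ((trivializationAt (Coord n) (TangentSpace (𝓡 n) : M → Type _) p).symmL ℝ q u)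
        ((trivializationAt (Coord n) (TangentSpace (𝓡 n) : M → Type _) p).symmL ℝ q v)))
        (chartAt (Coord n) p).source q := by
    apply ContMDiffWithinAt.clm_bundle_apply₂ (F₁ := Coord n) (F₂ := Coord n)
    · exact h.contMDiff.contMDiffAt.contMDiffWithinAt
    · exact contMDiffOn_chart_section p u q hq
    · exact contMDiffOn_chart_section p v q hq
  simp only [Bundle.contMDiffWithinAt_totalSpace] at this
  exact this.2

lemma contDiffOn_chartMetric_apply (h : Metric n M) (p : M) (u v : Coord n) :
    ContDiffOn ℝ ∞ (fun x => chartMetric h p x u v) (extChartAt (𝓡 n) p).target := by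
  rw [← contMDiffOn_iff_contDiffOn]
  exact (contMDiffOn_metric_chart h p u v).comp (contMDiffOn_extChartAt_symm p)
    fun x hx => chartPoint_mem hx

/-- In finite dimension, smoothness of an operator-valued map can be tested on fixed vectors. -/
lemma contDiffOn_chartMetric (h : Metric n M) (p : M) :
    ContDiffOn ℝ ∞ (chartMetric h p) (extChartAt (𝓡 n) p).target :=
  contDiffOn_clm_apply.2 fun u => contDiffOn_clm_apply.2 fun v =>
    contDiffOn_chartMetric_apply h p u v

lemma isLocalMetric_chartMetric (h : Metric n M) (p : M) :
    IsLocalMetric (chartMetric h p) (extChartAt (𝓡 n) p).target where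
  isOpen := isOpen_extChartAt_target p
  smooth := contDiffOn_chartMetric h p
  symm _ _ _ _ := h.symm _ _ _
  pos _ hx _ hu := h.pos _ _ (chartVector_ne_zero hx hu)

lemma isLocalNavigation_chart {h : Metric n M} {W : ∀ x : M, TangentSpace (𝓡 n) x}
    (hW : IsNavigationData h W) (p : M) :
    IsLocalNavigation (chartMetric h p) (chartField W p) (extChartAt (𝓡 n) p).target where
  toIsLocalMetric := isLocalMetric_chartMetric h p
  smooth_field := by
    rw [← contMDiffOn_iff_contDiffOn]
    have h1 : ContMDiffOn (𝓡 n) 𝓘(ℝ, Coord n) ∞ (fun q : M => vectorCoord p q (W q))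
        (chartAt (Coord n) p).source := by
      have := ((trivializationAt (Coord n) (TangentSpace (𝓡 n) : M → Type _)
        p).contMDiffOn_section_baseSet_iff (IB := 𝓡 n) (n := ∞) (s := W)).1
        hW.smooth.contMDiffOn
      refine this.congr fun q hq => ?_
      exact Bundle.Trivialization.continuousLinearMapAt_apply_of_mem (R := ℝ) _ hq _
    exact h1.comp (contMDiffOn_extChartAt_symm p) fun x hx => chartPoint_mem hx
  norm_lt_one x hx := by
    rw [chartMetric_apply, chartField, chartVector_vectorCoord hx]
    exact hW.norm_lt_one _

lemma randers_chartVector (h : Metric n M) (W : ∀ x : M, TangentSpace (𝓡 n) x) {p : M}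
    {x : Coord n} (hx : x ∈ (extChartAt (𝓡 n) p).target) (y : Coord n) :
    randers h W (chartPoint p x) (chartVector p x y)
      = localRanders (chartMetric h p) (chartField W p) (x, y) := by
  simp only [localRanders, chartMetric_apply, chartField, chartVector_vectorCoord hx]
  rfl

lemma energy_randers (h : Metric n M) (W : ∀ x : M, TangentSpace (𝓡 n) x) {p : M}
    {x : Coord n} (hx : x ∈ (extChartAt (𝓡 n) p).target) (y : Coord n) :
    energy (randers h W) p x y = localEnergy (chartMetric h p) (chartField W p) (x, y) := by
  rw [energy, randers_chartVector h W hx, localEnergy]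

end Charts

/-! ### Linearity of the Koszul expression in each slot. -/

section Koszul

variable {E : Type*} [NormedAddCommGroup E] [NormedSpace ℝ E] (D : E →L[ℝ] E →L[ℝ] E →L[ℝ] ℝ)
  (g : E →L[ℝ] E →L[ℝ] ℝ) (Γ : E →L[ℝ] E →L[ℝ] E) (u v z : E)

-- Linearity in each of the three slots reduces the Koszul formula to basis vectors.
set_option synthInstance.maxHeartbeats 400000 in
lemma koszul_isLinearMap_right :
    IsLinearMap ℝ fun z => 2 * g (Γ u v) z - (D u v z + D v u z - D z u v) :=
  ⟨fun a b => by simp only [D.map_add, map_add, add_apply]; ring,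
    fun c a => by simp only [D.map_smul, map_smul, smul_apply, smul_eq_mul]; ring⟩

set_option synthInstance.maxHeartbeats 400000 in
lemma koszul_isLinearMap_middle :
    IsLinearMap ℝ fun v => 2 * g (Γ u v) z - (D u v z + D v u z - D z u v) :=
  ⟨fun a b => by simp only [D.map_add, map_add, add_apply]; ring,
    fun c a => by simp only [D.map_smul, map_smul, smul_apply, smul_eq_mul]; ring⟩

set_option synthInstance.maxHeartbeats 400000 in
lemma koszul_isLinearMap_left :
    IsLinearMap ℝ fun u => 2 * g (Γ u v) z - (D u v z + D v u z - D z u v) :=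
  ⟨fun a b => by simp only [D.map_add, map_add, add_apply]; ring,
    fun c a => by simp only [D.map_smul, map_smul, smul_apply, smul_eq_mul]; ring⟩

lemma contDiffAt_smul_const {F : Type*} [NormedAddCommGroup F] [NormedSpace ℝ F] {f : E → ℝ}
    {x : E} {m : WithTop ℕ∞} (hf : ContDiffAt ℝ m f x) (c : F) :
    ContDiffAt ℝ m (fun y => f y • c) x := hf.smul contDiffAt_const

end Koszul

/-! ### Christoffel symbols as a bilinear map; the coordinate-free form of `∇W = 0`. -/

section ChristoffelMap

open Filter Topology

variable {n : ℕ} {M : Type*} [TopologicalSpace M] [ChartedSpace (Coord n) M]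
  [IsManifold (𝓡 n) ∞ M]

/-- The bilinear map `(u, v) ↦ uⁱ vʲ ∂ₖ`. -/
def coordBilin (k i j : Fin n) : Coord n →L[ℝ] Coord n →L[ℝ] Coord n :=
  ContinuousLinearMap.smulRight (EuclideanSpace.proj i : Coord n →L[ℝ] ℝ)
    (ContinuousLinearMap.smulRight (EuclideanSpace.proj j : Coord n →L[ℝ] ℝ)
      (EuclideanSpace.single k (1 : ℝ)))

lemma coordBilin_apply (k i j : Fin n) (u v : Coord n) :
    coordBilin k i j u v = (u i * v j) • EuclideanSpace.single k (1 : ℝ) := by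
  simp [coordBilin, smul_smul]

/-- The Levi-Civita connection of `h` in the chart at `p`, as a bilinear map. -/
def christoffelMap (h : Metric n M) (p : M) (x : Coord n) : Coord n →L[ℝ] Coord n →L[ℝ] Coord n :=
  ∑ k, ∑ i, ∑ j, christoffel h p x k i j • coordBilin k i j

lemma christoffelMap_apply (h : Metric n M) (p : M) (x u v : Coord n) (k : Fin n) :
    christoffelMap h p x u v k = ∑ i, ∑ j, christoffel h p x k i j * (u i * v j) := by
  simp [christoffelMap, coordBilin_apply, Finset.sum_apply, Pi.single_apply]

lemma leviCivitaCoeff_sum (h : Metric n M) (p : M) (x u y : Coord n) (k : Fin n) :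
    ∑ i, leviCivitaCoeff h p x y k i * u i = christoffelMap h p x u y k := by
  rw [christoffelMap_apply]
  refine Finset.sum_congr rfl fun i _ => ?_
  rw [leviCivitaCoeff, Finset.sum_mul]
  refine Finset.sum_congr rfl fun j _ => by ring

lemma christoffelMap_single (h : Metric n M) (p : M) (x y : Coord n) (k i : Fin n) :
    christoffelMap h p x (EuclideanSpace.single i 1) y k = leviCivitaCoeff h p x y k i := by
  rw [← leviCivitaCoeff_sum]
  simp

lemma partialDeriv_metricMatrix (h : Metric n M) {p : M} {x : Coord n}
    (hx : x ∈ (extChartAt (𝓡 n) p).target) (i j l : Fin n) :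
    partialDeriv i (fun z => metricMatrix h p z j l) x = fderiv ℝ (chartMetric h p) x
      (EuclideanSpace.single i 1) (EuclideanSpace.single j 1) (EuclideanSpace.single l 1) := by
  obtain ⟨L, h1, h2⟩ := hasFDerivAt_bilin_apply
    ((isLocalMetric_chartMetric h p).differentiableAt hx) (EuclideanSpace.single j 1) (EuclideanSpace.single l 1)
  rw [← h2]
  exact partialDeriv_eq h1 i

lemma isLeviCivitaAt_christoffelMap (h : Metric n M) {p : M} {x : Coord n}
    (hx : x ∈ (extChartAt (𝓡 n) p).target) :
    IsLeviCivitaAt (chartMetric h p) x (christoffelMap h p x) := by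
  have hM := isLocalMetric_chartMetric h p
  set g := chartMetric h p with hg
  set D := fderiv ℝ g x with hD
  set Γ := christoffelMap h p x with hΓ
  have basis : ∀ i j l : Fin n, 2 * g x (Γ (EuclideanSpace.single i 1) (EuclideanSpace.single j 1))
      (EuclideanSpace.single l 1) = D (EuclideanSpace.single i 1) (EuclideanSpace.single j 1)
      (EuclideanSpace.single l 1) + D (EuclideanSpace.single j 1) (EuclideanSpace.single i 1)
      (EuclideanSpace.single l 1) - D (EuclideanSpace.single l 1) (EuclideanSpace.single i 1)
      (EuclideanSpace.single j 1) := by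
    intro i j l
    -- The classical formula for the Christoffel symbols is the Koszul system solved by the inverse
    -- Gram matrix; taking `2Γ` as the unknown absorbs the factor `1/2`.
    have h1 := bilinMatrix_inv_spec (hM.pos x hx)
      (v := (2 : ℝ) • Γ (EuclideanSpace.single i 1) (EuclideanSpace.single j 1))
      (b := fun l => D (EuclideanSpace.single i 1) (EuclideanSpace.single j 1)
      (EuclideanSpace.single l 1) + D (EuclideanSpace.single j 1) (EuclideanSpace.single i 1)
      (EuclideanSpace.single l 1) - D (EuclideanSpace.single l 1) (EuclideanSpace.single i 1)
      (EuclideanSpace.single j 1)) (by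
        intro k
        have : Γ (EuclideanSpace.single i 1) (EuclideanSpace.single j 1) k
            = christoffel h p x k i j := by
          rw [hΓ, christoffelMap_single, leviCivitaCoeff]
          simp
        rw [PiLp.smul_apply, this, christoffel, smul_eq_mul]
        simp only [partialDeriv_metricMatrix h hx]
        rw [metricMatrix_eq]
        ring) l
    rw [hM.symm x hx, map_smul, smul_apply, smul_eq_mul] at h1
    exact h1
  intro u v z
  rw [← sub_eq_zero]
  refine isLinearMap_eq_zero (koszul_isLinearMap_right D (g x) Γ u v) (fun l => ?_) z
  refine isLinearMap_eq_zero (koszul_isLinearMap_middle D (g x) Γ u _) (fun j => ?_) v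
  refine isLinearMap_eq_zero (koszul_isLinearMap_left D (g x) Γ _ _) (fun i => ?_) u
  exact sub_eq_zero.2 (basis i j l)

/-- Class `C^1` is what the local existence theorem for parallel fields requires. -/
lemma contDiffAt_christoffelMap (h : Metric n M) {p : M} {x : Coord n}
    (hx : x ∈ (extChartAt (𝓡 n) p).target) : ContDiffAt ℝ 1 (christoffelMap h p) x := by
  have hM := isLocalMetric_chartMetric h p
  have hmat : ∀ i j, ContDiffAt ℝ ∞ (fun z => metricMatrix h p z i j) x := fun i j =>
    ((hM.contDiffAt hx).clm_apply contDiffAt_const).clm_apply contDiffAt_const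
  have hpd : ∀ i j l,
      ContDiffAt ℝ 1 (fun y => partialDeriv i (fun z => metricMatrix h p z j l) y) x :=
    fun i j l => ((hmat j l).fderiv_right (m := 1) (by norm_cast)).clm_apply contDiffAt_const
  have hch : ∀ k i j, ContDiffAt ℝ 1 (fun y => christoffel h p y k i j) x := by
    intro k i j
    refine contDiffAt_const.mul (ContDiffAt.sum fun l _ => ContDiffAt.mul ?_ ?_)
    · refine contDiffAt_matrix_inv (fun i j => (hmat i j).of_le (by norm_cast)) ?_ k l
      rw [metricMatrix_eq]
      exact det_bilinMatrix_ne_zero (hM.pos x hx)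
    · exact ((hpd _ _ _).add (hpd _ _ _)).sub (hpd _ _ _)
  exact ContDiffAt.sum fun k _ => ContDiffAt.sum fun i _ => ContDiffAt.sum fun j _ =>
    contDiffAt_smul_const (hch k i j) _

lemma isParallelField_iff {h : Metric n M} {W : ∀ x : M, TangentSpace (𝓡 n) x}
    (hW : IsNavigationData h W) :
    IsParallelField h W ↔ ∀ (p : M), ∀ x ∈ (extChartAt (𝓡 n) p).target, ∀ u,
      fderiv ℝ (chartField W p) x u + christoffelMap h p x u (chartField W p x) = 0 := by
  refine forall_congr' fun p => forall₂_congr fun x hx => ?_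
  have hd : DifferentiableAt ℝ (chartField W p) x :=
    ((isLocalNavigation_chart hW p).contDiffAt_field hx).differentiableAt (by simp)
  have hpd : ∀ k i, partialDeriv i
      (fun z => vectorCoord p (chartPoint p z) (W (chartPoint p z)) k) x
      = fderiv ℝ (chartField W p) x (EuclideanSpace.single i 1) k := by
    intro k i
    exact partialDeriv_eq ((EuclideanSpace.proj k : Coord n →L[ℝ] ℝ).hasFDerivAt.comp x
      hd.hasFDerivAt) i
  have hcoord : ∀ k i, partialDeriv i
      (fun z => vectorCoord p (chartPoint p z) (W (chartPoint p z)) k) x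
      + ∑ j, christoffel h p x k i j * vectorCoord p (chartPoint p x) (W (chartPoint p x)) j
      = (fderiv ℝ (chartField W p) x (EuclideanSpace.single i 1)
        + christoffelMap h p x (EuclideanSpace.single i 1) (chartField W p x)) k := by
    intro k i
    rw [hpd, PiLp.add_apply, christoffelMap_single]
    rfl
  simp only [hcoord]
  constructor
  · intro H u
    ext k
    refine isLinearMap_eq_zero (f := fun u => (fderiv ℝ (chartField W p) x u
      + christoffelMap h p x u (chartField W p x)) k)
      ⟨fun a b => by simp; ring, fun c a => by simp; ring⟩ (fun i => H k i) u
  · intro H k i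
    rw [H]
    rfl

end ChristoffelMap

/-! ### Spray and canonical connection of the Randers metric in a chart. -/

section Spray

open Filter Topology

variable {n : ℕ} {M : Type*} [TopologicalSpace M] [ChartedSpace (Coord n) M]
  [IsManifold (𝓡 n) ∞ M]

lemma hasFDerivAt_mk_left {E : Type*} [NormedAddCommGroup E] [NormedSpace ℝ E] (x y : E) :
    HasFDerivAt (fun z : E => (z, y)) (ContinuousLinearMap.inl ℝ E E) x :=
  hasFDerivAt_prodMk_left x y

/-- The vertical Hessian of a function of `(x, y)`. -/
def verticalHessian (g : Coord n × Coord n → ℝ) (z : Coord n × Coord n) :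
    Coord n →L[ℝ] Coord n →L[ℝ] ℝ :=
  (fderiv ℝ (fderiv ℝ g) z).bilinearComp (ContinuousLinearMap.inr ℝ _ _)
    (ContinuousLinearMap.inr ℝ _ _)

lemma verticalHessian_apply (g : Coord n × Coord n → ℝ) (z : Coord n × Coord n) (u v : Coord n) :
    verticalHessian g z u v = fderiv ℝ (fderiv ℝ g) z (0, u) (0, v) := rfl

variable {h : Metric n M} {W : ∀ x : M, TangentSpace (𝓡 n) x} (hW : IsNavigationData h W)
  {p : M} {x y : Coord n} (hx : x ∈ (extChartAt (𝓡 n) p).target) (hy : y ≠ 0)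

/-- The local energy of the Randers metric in the chart at `p`. -/
def chartEnergy (h : Metric n M) (W : ∀ x : M, TangentSpace (𝓡 n) x) (p : M)
    (z : Coord n × Coord n) : ℝ := localEnergy (chartMetric h p) (chartField W p) z

include hW hx hy

lemma contDiffAt_chartEnergy : ContDiffAt ℝ ∞ (chartEnergy h W p) (x, y) :=
  (isLocalNavigation_chart hW p).contDiffAt_localEnergy hx hy

lemma partialDeriv_energy_vertical (l : Fin n) :
    partialDeriv l (fun u => energy (randers h W) p x u) y
      = fderiv ℝ (chartEnergy h W p) (x, y) (0, EuclideanSpace.single l 1) := by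
  have h1 := ((contDiffAt_chartEnergy hW hx hy).differentiableAt (by simp)).hasFDerivAt.comp y
    (hasFDerivAt_mk_right x y)
  simp only [energy_randers h W hx]
  exact partialDeriv_eq h1 l

lemma partialDeriv_energy_horizontal (l : Fin n) :
    partialDeriv l (fun z => energy (randers h W) p z y) x
      = fderiv ℝ (chartEnergy h W p) (x, y) (EuclideanSpace.single l 1, 0) := by
  have h1 := ((contDiffAt_chartEnergy hW hx hy).differentiableAt (by simp)).hasFDerivAt.comp x
    (hasFDerivAt_mk_left x y)
  refine partialDeriv_eq (h1.congr_of_eventuallyEq ?_) l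
  filter_upwards [(isOpen_extChartAt_target p).mem_nhds hx] with z hz using energy_randers h W hz y

lemma finslerMatrix_eq :
    finslerMatrix (randers h W) p x y
      = bilinMatrix (verticalHessian (chartEnergy h W p) (x, y)) := by
  ext i j
  have h1 := (hasFDerivAt_fderiv_mk_right (contDiffAt_chartEnergy hW hx hy)).clm_apply
    (hasFDerivAt_const ((0 : Coord n), (EuclideanSpace.single j (1 : ℝ) : Coord n)) y)
  have h2 := h1.congr_of_eventuallyEq
    (f₁ := fun z => partialDeriv j (fun u => energy (randers h W) p x u) z) (by
      filter_upwards [isOpen_ne.mem_nhds hy] with z hz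
        using partialDeriv_energy_vertical hW hx hz j)
  refine (partialDeriv_eq h2 i).trans ?_
  simp [bilinMatrix, verticalHessian_apply]

lemma partialDeriv_energy_mixed (l m : Fin n) :
    partialDeriv m (fun z => partialDeriv l (fun u => energy (randers h W) p z u) y) x
      = fderiv ℝ (fderiv ℝ (chartEnergy h W p)) (x, y) (EuclideanSpace.single m 1, 0)
        (0, EuclideanSpace.single l 1) := by
  have h1 := ((differentiableAt_fderiv (contDiffAt_chartEnergy hW hx hy)).hasFDerivAt.comp x
    (hasFDerivAt_mk_left x y)).clm_apply
    (hasFDerivAt_const ((0 : Coord n), (EuclideanSpace.single l (1 : ℝ) : Coord n)) x)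
  have h2 := h1.congr_of_eventuallyEq
    (f₁ := fun z => partialDeriv l (fun u => energy (randers h W) p z u) y) (by
      filter_upwards [(isOpen_extChartAt_target p).mem_nhds hx] with z hz
        using partialDeriv_energy_vertical hW hz hy l)
  refine (partialDeriv_eq h2 m).trans ?_
  simp

lemma sprayCoeff_eq (k : Fin n) :
    sprayCoeff (randers h W) p x y k = (1 / 2) * ∑ l,
      (bilinMatrix (verticalHessian (chartEnergy h W p) (x, y)))⁻¹ k l *
      (fderiv ℝ (fderiv ℝ (chartEnergy h W p)) (x, y) (y, 0) (0, EuclideanSpace.single l 1)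
        - fderiv ℝ (chartEnergy h W p) (x, y) (EuclideanSpace.single l 1, 0)) := by
  rw [sprayCoeff, finslerMatrix_eq hW hx hy]
  congr 1
  refine Finset.sum_congr rfl fun l _ => ?_
  rw [partialDeriv_energy_horizontal hW hx hy]
  simp only [partialDeriv_energy_mixed hW hx hy]
  have h1 := clm_apply_eq_sum ((((fderiv ℝ (fderiv ℝ (chartEnergy h W p)) (x, y)).comp
    (ContinuousLinearMap.inl ℝ _ _)).flip
    ((0 : Coord n), (EuclideanSpace.single l (1 : ℝ) : Coord n)))) y
  simp at h1
  rw [h1]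

lemma verticalHessian_pos (u : Coord n) (hu : u ≠ 0) :
    0 < verticalHessian (chartEnergy h W p) (x, y) u u :=
  (isLocalNavigation_chart hW p).hessian_localEnergy_pos hx hy hu

/-- The connection coefficients are values of `fderiv`, which carry information only where the spray
coefficient is differentiable; the integrability argument needs a genuine differential. -/
lemma differentiableAt_sprayCoeff (k : Fin n) :
    DifferentiableAt ℝ (fun z => sprayCoeff (randers h W) p x z k) y := by
  have hE := contDiffAt_chartEnergy hW hx hy
  have hm : ContDiffAt ℝ ∞ (fun z : Coord n => (x, z)) y := contDiffAt_const.prodMk contDiffAt_id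
  have h1 : ContDiffAt ℝ ∞ (fun z => fderiv ℝ (chartEnergy h W p) (x, z)) y :=
    (hE.fderiv_right (m := ∞) (by simp)).comp y hm
  have h2 : ContDiffAt ℝ ∞ (fun z => fderiv ℝ (fderiv ℝ (chartEnergy h W p)) (x, z)) y :=
    ((hE.fderiv_right (m := ∞) (by simp)).fderiv_right (m := ∞) (by simp)).comp y hm
  have h3 : ContDiffAt ℝ ∞ (fun z => (1 / 2) * ∑ l,
      (bilinMatrix (verticalHessian (chartEnergy h W p) (x, z)))⁻¹ k l *
      (fderiv ℝ (fderiv ℝ (chartEnergy h W p)) (x, z) (z, 0) (0, EuclideanSpace.single l 1)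
        - fderiv ℝ (chartEnergy h W p) (x, z) (EuclideanSpace.single l 1, 0))) y := by
    refine contDiffAt_const.mul (ContDiffAt.sum fun l _ => ContDiffAt.mul ?_ (ContDiffAt.sub ?_ ?_))
    · refine contDiffAt_matrix_inv
        (A := fun z => bilinMatrix (verticalHessian (chartEnergy h W p) (x, z))) (fun i j => ?_)
        (det_bilinMatrix_ne_zero (verticalHessian_pos hW hx hy)) k l
      exact (h2.clm_apply contDiffAt_const).clm_apply contDiffAt_const
    · exact (h2.clm_apply (contDiffAt_id.prodMk contDiffAt_const)).clm_apply contDiffAt_const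
    · exact h1.clm_apply contDiffAt_const
  refine (h3.differentiableAt (by simp)).congr_of_eventuallyEq ?_
  filter_upwards [isOpen_ne.mem_nhds hy] with z hz using sprayCoeff_eq hW hx hz k

/-- By the spray equation `Γ(y, y)` solves the linear system with matrix `g_ij`, and positive
definiteness makes the solution unique. -/
lemma sprayCoeff_of_parallel (hP : IsParallelField h W) (k : Fin n) :
    sprayCoeff (randers h W) p x y k = (1 / 2) * christoffelMap h p x y y k := by
  rw [sprayCoeff_eq hW hx hy]
  congr 1
  refine bilinMatrix_inv_unique (verticalHessian_pos hW hx hy) (fun l => ?_) k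
  have hN := isLocalNavigation_chart hW p
  have h1 := hN.spray_equation hx hy (isLeviCivitaAt_christoffelMap h hx)
    ((isParallelField_iff hW).1 hP p x hx) (EuclideanSpace.single l 1)
  rw [verticalHessian_apply]
  exact (hN.hessian_localEnergy_symm hx hy _ _).trans h1.symm

/-- The derivative of `½ Γ(y, y)` in direction `i` is `Γ(∂ᵢ, y)`, the symmetry of `Γ` merging the
two halves. -/
lemma finslerCoeff_of_parallel (hP : IsParallelField h W) (k i : Fin n) :
    finslerCoeff (randers h W) p x y k i = leviCivitaCoeff h p x y k i := by
  have h1 := ((christoffelMap h p x).hasFDerivAt.clm_apply (hasFDerivAt_id y))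
  have h2 := ((EuclideanSpace.proj k : Coord n →L[ℝ] ℝ).hasFDerivAt.comp y h1).const_mul (1 / 2)
  have h3 := h2.congr_of_eventuallyEq
    (f₁ := fun z => sprayCoeff (randers h W) p x z k) (by
      filter_upwards [isOpen_ne.mem_nhds hy] with z hz
        using sprayCoeff_of_parallel hW hx hz hP k)
  rw [finslerCoeff, partialDeriv_eq h3 i, ← christoffelMap_single]
  have := (isLocalMetric_chartMetric h p).leviCivita_symm hx (isLeviCivitaAt_christoffelMap h hx)
    y (EuclideanSpace.single i 1)
  simp [this]
  ring

end Spray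

lemma isBerwald_of_parallel {n : ℕ} {M : Type*} [TopologicalSpace M] [ChartedSpace (Coord n) M]
    [IsManifold (𝓡 n) ∞ M] {h : Metric n M} {W : ∀ x : M, TangentSpace (𝓡 n) x}
    (hW : IsNavigationData h W) (hP : IsParallelField h W) : IsBerwald (randers h W) :=
  fun p x hx => ⟨christoffel h p x, fun _ hy k i => finslerCoeff_of_parallel hW hx hy hP k i⟩

/-! ### Derivatives along curves and a local existence theorem for linear equations. -/

section Calculus

variable {E : Type*} [NormedAddCommGroup E] [NormedSpace ℝ E]

lemma hasDerivWithinAt_comp_curve {F : Type*} [NormedAddCommGroup F] [NormedSpace ℝ F] {g : E → F}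
    {x : ℝ → E} {x' : E} {S : Set ℝ} {t : ℝ} (hg : DifferentiableAt ℝ g (x t))
    (hx : HasDerivWithinAt x x' S t) :
    HasDerivWithinAt (fun s => g (x s)) (fderiv ℝ g (x t) x') S t :=
  hg.hasFDerivAt.comp_hasDerivWithinAt t hx

set_option synthInstance.maxHeartbeats 400000 in
lemma hasDerivWithinAt_bilin_self {H : E → E →L[ℝ] E →L[ℝ] ℝ} {x y : ℝ → E} {x' y' : E}
    {S : Set ℝ} {t : ℝ} (hH : DifferentiableAt ℝ H (x t)) (hx : HasDerivWithinAt x x' S t)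
    (hy : HasDerivWithinAt y y' S t) :
    HasDerivWithinAt (fun s => H (x s) (y s) (y s))
      (fderiv ℝ H (x t) x' (y t) (y t) + H (x t) y' (y t) + H (x t) (y t) y') S t := by
  have h0 := hasDerivWithinAt_comp_curve (F := E →L[ℝ] E →L[ℝ] ℝ) hH hx
  refine ((h0.clm_apply hy).clm_apply hy).congr_deriv ?_
  simp

lemma hasDerivWithinAt_fderiv_apply {φ : E → E} {x y : ℝ → E} {x' y' : E}
    {S : Set ℝ} {t : ℝ} (hφ : ContDiffAt ℝ ∞ φ (x t)) (hx : HasDerivWithinAt x x' S t)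
    (hy : HasDerivWithinAt y y' S t) :
    HasDerivWithinAt (fun s => fderiv ℝ φ (x s) (y s))
      (fderiv ℝ (fderiv ℝ φ) (x t) x' (y t) + fderiv ℝ φ (x t) y') S t :=
  ((differentiableAt_fderiv hφ).hasFDerivAt.comp_hasDerivWithinAt t hx).clm_apply hy

lemma exists_linear_ode_solution [CompleteSpace E] {Γ : E → E →L[ℝ] E →L[ℝ] E} {x₀ : E}
    (hΓ : ContDiffAt ℝ 1 Γ x₀) (e y₀ : E) :
    ∃ ε > 0, ∃ y : ℝ → E, y 0 = y₀ ∧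
      ∀ t ∈ Set.Ico 0 ε, HasDerivAt y (-Γ (x₀ + t • e) e (y t)) t := by
  -- Adjoining time as a first component of speed one makes the equation autonomous; `hfst` later
  -- identifies that component with `t`.
  have hf : ContDiffAt ℝ 1 (fun z : ℝ × E => ((1 : ℝ), -Γ (x₀ + z.1 • e) e z.2)) (0, y₀) := by
    have hl : ContDiffAt ℝ 1 (fun z : ℝ × E => x₀ + z.1 • e) (0, y₀) :=
      contDiffAt_const.add (contDiffAt_fst.smul contDiffAt_const)
    have hΓ' : ContDiffAt ℝ 1 Γ (x₀ + ((0 : ℝ), y₀).1 • e) := by simpa using hΓ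
    exact contDiffAt_const.prodMk
      (((hΓ'.comp (0, y₀) hl).clm_apply contDiffAt_const).clm_apply contDiffAt_snd).neg
  obtain ⟨α, hα0, ε, hε, hα⟩ :=
    hf.exists_forall_mem_closedBall_exists_eq_forall_mem_Ioo_hasDerivAt₀ 0
  have hIoo : ∀ t ∈ Set.Ico 0 ε, t ∈ Set.Ioo (0 - ε) (0 + ε) := fun t ht =>
    ⟨by linarith [ht.1], by linarith [ht.2]⟩
  have hα1 : ∀ t ∈ Set.Ico 0 ε, HasDerivAt (fun s => (α s).1) 1 t := fun t ht =>
    (ContinuousLinearMap.fst ℝ ℝ E).hasFDerivAt.comp_hasDerivAt t (hα t (hIoo t ht))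
  have hα2 : ∀ t ∈ Set.Ico 0 ε, HasDerivAt (fun s => (α s).2)
      (-Γ (x₀ + (α t).1 • e) e (α t).2) t := fun t ht =>
    (ContinuousLinearMap.snd ℝ ℝ E).hasFDerivAt.comp_hasDerivAt t (hα t (hIoo t ht))
  have hfst : ∀ t ∈ Set.Ico 0 ε, (α t).1 = t := by
    intro t ht
    have h0 : ∀ s ∈ Set.Icc 0 t, HasDerivAt (fun s => (α s).1 - s) 0 s := fun s hs => by
      simpa using (hα1 s ⟨hs.1, hs.2.trans_lt ht.2⟩).fun_sub (hasDerivAt_id' s)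
    have h1 := constant_of_has_deriv_right_zero
      (fun s hs => (h0 s hs).continuousAt.continuousWithinAt)
      (fun s hs => (h0 s (Set.Ico_subset_Icc_self hs)).hasDerivWithinAt) t ⟨ht.1, le_rfl⟩
    rw [hα0] at h1
    linarith
  refine ⟨ε, hε, fun t => (α t).2, by simp [hα0], fun t ht => ?_⟩
  have h2 := hα2 t ht
  rwa [hfst t ht] at h2

end Calculus

/-! ### Changes of coordinates and the Christoffel symbols. -/

section CoordinateChange

open Filter Topology

variable {n : ℕ} {M : Type*} [TopologicalSpace M] [ChartedSpace (Coord n) M]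
  [IsManifold (𝓡 n) ∞ M]

/-- The change of coordinates from the chart at `p` to the chart at `q`. -/
def coordChange (p q : M) (x : Coord n) : Coord n := extChartAt (𝓡 n) q (chartPoint p x)

/-- The domain of the change of coordinates. -/
def overlap (p q : M) : Set (Coord n) :=
  (extChartAt (𝓡 n) p).target ∩ chartPoint p ⁻¹' (chartAt (Coord n) q).source

variable (p q : M)

omit [IsManifold (𝓡 n) ∞ M] in
lemma isOpen_overlap : IsOpen (overlap p q : Set (Coord n)) :=
  (continuousOn_extChartAt_symm p).isOpen_inter_preimage (isOpen_extChartAt_target p)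
    (chartAt (Coord n) q).open_source

variable {p q}

omit [IsManifold (𝓡 n) ∞ M] in
lemma mem_overlap {m : M} (hp : m ∈ (chartAt (Coord n) p).source)
    (hq : m ∈ (chartAt (Coord n) q).source) : extChartAt (𝓡 n) p m ∈ overlap p q :=
  ⟨extChartAt_mem_target hp, by rwa [Set.mem_preimage, chartPoint_extChartAt hp]⟩

lemma contDiffAt_coordChange {x : Coord n} (hx : x ∈ overlap p q) :
    ContDiffAt ℝ ∞ (coordChange p q) x := by
  rw [← contMDiffAt_iff_contDiffAt]
  have h1 : ContMDiffAt 𝓘(ℝ, Coord n) (𝓡 n) ∞ (chartPoint p) x :=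
    (contMDiffOn_extChartAt_symm p).contMDiffAt ((isOpen_extChartAt_target p).mem_nhds hx.1)
  have h2 : ContMDiffAt (𝓡 n) 𝓘(ℝ, Coord n) ∞ (extChartAt (𝓡 n) q) (chartPoint p x) :=
    contMDiffAt_extChartAt' hx.2
  exact h2.comp x h1

/-- Both coordinate vectors are obtained from the preferred chart at `m` by the cocycle of the
tangent bundle, so the cocycle identity relates them. -/
lemma vectorCoord_coordChange {m : M} (hp : m ∈ (chartAt (Coord n) p).source)
    (hq : m ∈ (chartAt (Coord n) q).source) (v : TangentSpace (𝓡 n) m) :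
    vectorCoord q m v
      = fderiv ℝ (coordChange p q) (extChartAt (𝓡 n) p m) (vectorCoord p m v) := by
  have h1 : ∀ p : M, m ∈ (chartAt (Coord n) p).source →
      vectorCoord p m v = tangentCoordChange (𝓡 n) m p m v := by
    intro p hp
    rw [vectorCoord, TangentBundle.continuousLinearMapAt_trivializationAt_eq_core hp]
    rfl
  have h2 : fderiv ℝ (coordChange p q) (extChartAt (𝓡 n) p m)
      = tangentCoordChange (𝓡 n) p q m := by
    rw [tangentCoordChange_def]
    simp [fderivWithin_univ]
    rfl
  rw [h2, h1 p hp, h1 q hq]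
  refine (tangentCoordChange_comp (I := 𝓡 n) (v := v) ?_).symm
  simp only [extChartAt_source]
  exact ⟨⟨mem_chart_source _ m, hp⟩, hq⟩

lemma chartMetric_coordChange (h : Metric n M) {x : Coord n} (hx : x ∈ overlap p q)
    (u v : Coord n) :
    chartMetric h p x u v = chartMetric h q (coordChange p q x)
      (fderiv ℝ (coordChange p q) x u) (fderiv ℝ (coordChange p q) x v) := by
  have hp := chartPoint_mem hx.1
  have e : ∀ u, fderiv ℝ (coordChange p q) x u
      = vectorCoord q (chartPoint p x) (chartVector p x u) := by
    intro u
    rw [vectorCoord_coordChange hp hx.2, vectorCoord_chartVector hx.1, extChartAt_chartPoint hx.1]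
  rw [e, e, coordChange, chartMetric_vectorCoord h hx.2, chartMetric_apply]

lemma fderiv_coordChange_surjective {x : Coord n} (hx : x ∈ overlap p q) :
    Function.Surjective (fderiv ℝ (coordChange p q) x) := by
  intro v
  have hp := chartPoint_mem hx.1
  have h1 := Bundle.Trivialization.continuousLinearMapAt_symmL (R := ℝ)
    (trivializationAt (Coord n) (TangentSpace (𝓡 n) : M → Type _) q) (b := chartPoint p x) hx.2 v
  have h2 := vectorCoord_coordChange hp hx.2 ((trivializationAt (Coord n)
    (TangentSpace (𝓡 n) : M → Type _) q).symmL ℝ (chartPoint p x) v)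
  rw [extChartAt_chartPoint hx.1] at h2
  exact ⟨_, h2.symm.trans h1⟩

/-- The transformation rule of the Christoffel symbols. -/
lemma christoffelMap_coordChange (h : Metric n M) {x : Coord n} (hx : x ∈ overlap p q)
    (u v : Coord n) :
    fderiv ℝ (coordChange p q) x (christoffelMap h p x u v) =
      christoffelMap h q (coordChange p q x) (fderiv ℝ (coordChange p q) x u)
        (fderiv ℝ (coordChange p q) x v) + fderiv ℝ (fderiv ℝ (coordChange p q)) x u v := by
  have hq : coordChange p q x ∈ (extChartAt (𝓡 n) q).target := extChartAt_mem_target hx.2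
  exact leviCivita_naturality (isLocalMetric_chartMetric h q) hx (isOpen_overlap p q) hq
    (contDiffAt_coordChange hx) (fderiv_coordChange_surjective hx)
    (fun y hy => chartMetric_coordChange h hy)
    ((isLocalMetric_chartMetric h p).differentiableAt hx.1)
    (isLeviCivitaAt_christoffelMap h hx.1) (isLeviCivitaAt_christoffelMap h hq) u v

end CoordinateChange

/-! ### Parallel fields along curves: linearity, isometry, uniqueness, local existence. -/

section Transport

open Filter Topology Set

variable {n : ℕ} {M : Type*} [TopologicalSpace M] [ChartedSpace (Coord n) M]
  [IsManifold (𝓡 n) ∞ M] {c : ℝ → M} {a b : ℝ}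

lemma IsParallelAlong.congr_coeff {Γ₁ Γ₂ : ConnectionCoeff n M}
    {V : ∀ t, TangentSpace (𝓡 n) (c t)} (hV : IsParallelAlong Γ₁ c a b V)
    (h : ∀ (p : M), ∀ t ∈ Icc a b, c t ∈ (chartAt (Coord n) p).source → ∀ k i,
      Γ₁ p (extChartAt (𝓡 n) p (c t)) (vectorCoord p (c t) (V t)) k i
        = Γ₂ p (extChartAt (𝓡 n) p (c t)) (vectorCoord p (c t) (V t)) k i) :
    IsParallelAlong Γ₂ c a b V := by
  intro p t ht hct k
  have := hV p t ht hct k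
  simpa only [h p t ht hct] using this

/-- The velocity of the curve `c` in the chart at `p`. -/
def chartVelocity (c : ℝ → M) (a b : ℝ) (p : M) (t : ℝ) : Coord n :=
  derivWithin (fun s => extChartAt (𝓡 n) p (c s)) (Icc a b) t

lemma metric_eq_zero (h : Metric n M) {q : M} {v : TangentSpace (𝓡 n) q}
    (hv : h.inner q v v = 0) : v = 0 := by
  by_contra hne
  exact (h.pos q v hne).ne' hv

lemma chartField_extChartAt (W : ∀ x : M, TangentSpace (𝓡 n) x) {p q : M}
    (hq : q ∈ (chartAt (Coord n) p).source) :
    chartField W p (extChartAt (𝓡 n) p q) = vectorCoord p q (W q) := by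
  rw [chartField, chartPoint_extChartAt hq]

section Curve

variable (hab : a < b) (hc : ContMDiffOn 𝓘(ℝ, ℝ) (𝓡 n) 1 c (Icc a b))
include hc

omit [IsManifold (𝓡 n) ∞ M] in
lemma eventually_mem_source {p : M} {t : ℝ} (ht : t ∈ Icc a b)
    (hct : c t ∈ (chartAt (Coord n) p).source) :
    ∀ᶠ s in 𝓝[Icc a b] t, c s ∈ (chartAt (Coord n) p).source :=
  (hc.continuousOn t ht).eventually ((chartAt (Coord n) p).open_source.mem_nhds hct)

lemma hasDerivWithinAt_chart {p : M} {t : ℝ} (ht : t ∈ Icc a b)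
    (hct : c t ∈ (chartAt (Coord n) p).source) :
    HasDerivWithinAt (fun s => extChartAt (𝓡 n) p (c s)) (chartVelocity c a b p t) (Icc a b) t := by
  have h2 : ContMDiffAt (𝓡 n) 𝓘(ℝ, Coord n) 1 (extChartAt (𝓡 n) p) (c t) :=
    contMDiffAt_extChartAt' hct
  have h3 : ContMDiffWithinAt 𝓘(ℝ, ℝ) 𝓘(ℝ, Coord n) 1 (fun s => extChartAt (𝓡 n) p (c s))
      (Icc a b) t := h2.comp_contMDiffWithinAt t (hc t ht)
  exact ((contMDiffWithinAt_iff_contDiffWithinAt.1 h3).differentiableWithinAt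
    (by simp)).hasDerivWithinAt

include hab

lemma derivWithin_chart_coord {p : M} {t : ℝ} (ht : t ∈ Icc a b)
    (hct : c t ∈ (chartAt (Coord n) p).source) (i : Fin n) :
    derivWithin (fun s => extChartAt (𝓡 n) p (c s) i) (Icc a b) t = chartVelocity c a b p t i :=
  (hasDerivWithinAt_coord.1 (hasDerivWithinAt_chart hc ht hct) i).derivWithin
    (uniqueDiffOn_Icc hab t ht)

/-- Riemannian parallelism in terms of the Christoffel map. -/
lemma isParallelAlong_leviCivita_iff {h : Metric n M} {V : ∀ t, TangentSpace (𝓡 n) (c t)} :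
    IsParallelAlong (leviCivitaCoeff h) c a b V ↔
      ∀ (p : M), ∀ t ∈ Icc a b, c t ∈ (chartAt (Coord n) p).source →
        HasDerivWithinAt (fun s => vectorCoord p (c s) (V s))
          (-christoffelMap h p (extChartAt (𝓡 n) p (c t)) (chartVelocity c a b p t)
            (vectorCoord p (c t) (V t))) (Icc a b) t := by
  refine forall_congr' fun p => forall₃_congr fun t ht hct => ?_
  rw [hasDerivWithinAt_coord]
  refine forall_congr' fun k => ?_
  simp only [derivWithin_chart_coord hab hc ht hct, leviCivitaCoeff_sum, PiLp.neg_apply]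

/-- The velocity is a derivative within the interval, so shrinking the interval requires comparing
the two one-sided notions at the new endpoint; differentiability of the curve makes them equal. -/
lemma IsParallelAlong.restrict {Γ : ConnectionCoeff n M} {V : ∀ t, TangentSpace (𝓡 n) (c t)}
    (hV : IsParallelAlong Γ c a b V) {b' : ℝ} (hb' : a < b') (hbb' : b' ≤ b) :
    IsParallelAlong Γ c a b' V := by
  intro p t ht hct k
  have hsub : Icc a b' ⊆ Icc a b := Icc_subset_Icc_right hbb'
  have h1 := (hV p t (hsub ht) hct k).mono hsub
  have h2 : ∀ i, derivWithin (fun s => extChartAt (𝓡 n) p (c s) i) (Icc a b') t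
      = derivWithin (fun s => extChartAt (𝓡 n) p (c s) i) (Icc a b) t := by
    intro i
    rw [derivWithin_chart_coord hab hc (hsub ht) hct]
    exact ((hasDerivWithinAt_coord.1 (hasDerivWithinAt_chart hc (hsub ht) hct) i).mono
      hsub).derivWithin (uniqueDiffOn_Icc hb' t ht)
  simpa only [h2] using h1

section LeviCivita

variable {h : Metric n M} {V V₁ V₂ : ∀ t, TangentSpace (𝓡 n) (c t)}

lemma IsParallelAlong.add (h₁ : IsParallelAlong (leviCivitaCoeff h) c a b V₁)
    (h₂ : IsParallelAlong (leviCivitaCoeff h) c a b V₂) :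
    IsParallelAlong (leviCivitaCoeff h) c a b (fun t => V₁ t + V₂ t) := by
  rw [isParallelAlong_leviCivita_iff hab hc] at *
  intro p t ht hct
  simp only [vectorCoord_add, map_add, neg_add]
  exact (h₁ p t ht hct).add (h₂ p t ht hct)

lemma IsParallelAlong.smul (h₁ : IsParallelAlong (leviCivitaCoeff h) c a b V) (r : ℝ) :
    IsParallelAlong (leviCivitaCoeff h) c a b (fun t => r • V t) := by
  rw [isParallelAlong_leviCivita_iff hab hc] at *
  intro p t ht hct
  simp only [vectorCoord_smul, map_smul, ← smul_neg]
  exact (h₁ p t ht hct).const_smul r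

lemma IsParallelAlong.sub (h₁ : IsParallelAlong (leviCivitaCoeff h) c a b V₁)
    (h₂ : IsParallelAlong (leviCivitaCoeff h) c a b V₂) :
    IsParallelAlong (leviCivitaCoeff h) c a b (fun t => V₁ t - V₂ t) := by
  simpa [sub_eq_add_neg] using h₁.add hab hc (h₂.smul hab hc (-1))

/-- Riemannian parallel translation preserves the norm. -/
lemma IsParallelAlong.inner_self_eq (hV : IsParallelAlong (leviCivitaCoeff h) c a b V) :
    ∀ t ∈ Icc a b, h.inner (c t) (V t) (V t) = h.inner (c a) (V a) (V a) := by
  rw [isParallelAlong_leviCivita_iff hab hc] at hV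
  have key : ∀ t ∈ Icc a b,
      HasDerivWithinAt (fun s => h.inner (c s) (V s) (V s)) 0 (Icc a b) t := by
    intro t ht
    -- Constancy is infinitesimal, so each time may be treated in the preferred chart at `c t`.
    have hct : c t ∈ (chartAt (Coord n) (c t)).source := mem_chart_source _ _
    set p := c t with hp
    have hx : extChartAt (𝓡 n) p (c t) ∈ (extChartAt (𝓡 n) p).target := extChartAt_mem_target hct
    have hM := isLocalMetric_chartMetric h p
    have h1 := hasDerivWithinAt_chart hc ht hct
    have h2 := hV p t ht hct
    have h4 := hasDerivWithinAt_bilin_self (hM.differentiableAt hx) h1 h2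
    refine (h4.congr_of_eventuallyEq ?_ ?_).congr_deriv ?_
    · filter_upwards [eventually_mem_source hc ht hct] with s hs
        using (chartMetric_vectorCoord h hs _ _).symm
    · exact (chartMetric_vectorCoord h hct _ _).symm
    · have h5 := hM.leviCivita_compat hx (isLeviCivitaAt_christoffelMap h hx)
        (chartVelocity c a b p t) (vectorCoord p (c t) (V t)) (vectorCoord p (c t) (V t))
      rw [h5]
      simp only [map_neg, neg_apply]
      ring
  exact constant_of_derivWithin_zero (fun t ht => (key t ht).differentiableWithinAt)
    fun t ht => (key t (Ico_subset_Icc_self ht)).derivWithin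
      (uniqueDiffOn_Icc hab t (Ico_subset_Icc_self ht))

lemma IsParallelAlong.ne_zero (hV : IsParallelAlong (leviCivitaCoeff h) c a b V) (ha : V a ≠ 0) :
    ∀ t ∈ Icc a b, V t ≠ 0 := by
  intro t ht h0
  have h1 := hV.inner_self_eq hab hc t ht
  rw [h0, map_zero] at h1
  exact ha (metric_eq_zero h h1.symm)

/-- The difference is parallel with initial norm zero, and norms are preserved; no uniqueness
theorem for differential equations is involved. -/
lemma IsParallelAlong.unique (h₁ : IsParallelAlong (leviCivitaCoeff h) c a b V₁)
    (h₂ : IsParallelAlong (leviCivitaCoeff h) c a b V₂) (ha : V₁ a = V₂ a) :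
    ∀ t ∈ Icc a b, V₁ t = V₂ t := by
  intro t ht
  have h3 := (h₁.sub hab hc h₂).inner_self_eq hab hc t ht
  simp only [ha, sub_self, map_zero] at h3
  exact sub_eq_zero.1 (metric_eq_zero h h3)

/-- A parallel vector field on `M` is parallel along every curve. -/
lemma IsParallelField.isParallelAlong {W : ∀ x : M, TangentSpace (𝓡 n) x}
    (hW : IsNavigationData h W) (hP : IsParallelField h W) :
    IsParallelAlong (leviCivitaCoeff h) c a b (fun t => W (c t)) := by
  rw [isParallelAlong_leviCivita_iff hab hc]
  intro p t ht hct
  have hx := extChartAt_mem_target hct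
  have hd : DifferentiableAt ℝ (chartField W p) (extChartAt (𝓡 n) p (c t)) :=
    ((isLocalNavigation_chart hW p).contDiffAt_field hx).differentiableAt (by simp)
  have h1 := hd.hasFDerivAt.comp_hasDerivWithinAt t (hasDerivWithinAt_chart hc ht hct)
  refine (h1.congr_of_eventuallyEq ?_ ?_).congr_deriv ?_
  · filter_upwards [eventually_mem_source hc ht hct] with s hs
      using (chartField_extChartAt W hs).symm
  · exact (chartField_extChartAt W hct).symm
  · rw [← chartField_extChartAt W hct]
    exact eq_neg_of_add_eq_zero_left ((isParallelField_iff hW).1 hP p _ hx _)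

/-- Riemannian parallelism can be tested in a single chart. -/
lemma isParallelAlong_of_chart (p : M)
    (hp : ∀ t ∈ Icc a b, c t ∈ (chartAt (Coord n) p).source)
    (hV : ∀ t ∈ Icc a b, HasDerivWithinAt (fun s => vectorCoord p (c s) (V s))
      (-christoffelMap h p (extChartAt (𝓡 n) p (c t)) (chartVelocity c a b p t)
        (vectorCoord p (c t) (V t))) (Icc a b) t) :
    IsParallelAlong (leviCivitaCoeff h) c a b V := by
  rw [isParallelAlong_leviCivita_iff hab hc]
  intro q t ht hq
  have hx := mem_overlap (hp t ht) hq
  have hφ := contDiffAt_coordChange hx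
  have h1 := hasDerivWithinAt_chart hc ht (hp t ht)
  have hz : chartVelocity c a b q t
      = fderiv ℝ (coordChange p q) (extChartAt (𝓡 n) p (c t)) (chartVelocity c a b p t) := by
    have h2 := (hφ.differentiableAt (by simp)).hasFDerivAt.comp_hasDerivWithinAt t h1
    refine (h2.congr_of_mem (fun s hs => ?_) ht).derivWithin (uniqueDiffOn_Icc hab t ht)
    rw [Function.comp_apply, coordChange, chartPoint_extChartAt (hp s hs)]
  have h3 := hasDerivWithinAt_fderiv_apply hφ h1 (hV t ht)
  refine (h3.congr_of_eventuallyEq ?_ ?_).congr_deriv ?_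
  · filter_upwards [eventually_mem_source hc ht hq, self_mem_nhdsWithin] with s hs hs'
      using vectorCoord_coordChange (hp s hs') hs _
  · exact vectorCoord_coordChange (hp t ht) hq _
  -- The second-derivative term from differentiating the coordinate change cancels the inhomogeneous
  -- term in the transformation rule.
  · have h4 := christoffelMap_coordChange h hx (chartVelocity c a b p t)
      (vectorCoord p (c t) (V t))
    have h5 : coordChange p q (extChartAt (𝓡 n) p (c t)) = extChartAt (𝓡 n) q (c t) := by
      rw [coordChange, chartPoint_extChartAt (hp t ht)]
    rw [hz, vectorCoord_coordChange (hp t ht) hq, ← h5]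
    simp only [map_neg, h4]
    abel

end LeviCivita

end Curve

omit [IsManifold (𝓡 n) ∞ M] in
lemma chartVelocity_line {p : M} {x₀ e : Coord n} {T : ℝ} (hT : 0 < T)
    (htarget : ∀ t ∈ Icc 0 T, x₀ + t • e ∈ (extChartAt (𝓡 n) p).target) {t : ℝ}
    (ht : t ∈ Icc 0 T) :
    chartVelocity (fun t : ℝ => chartPoint p (x₀ + t • e)) 0 T p t = e := by
  have h1 : HasDerivWithinAt (fun t : ℝ => x₀ + t • e) e (Icc 0 T) t := by
    simpa using (((hasDerivAt_id t).smul_const e).const_add x₀).hasDerivWithinAt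
  exact (h1.congr_of_mem (fun s hs => extChartAt_chartPoint (htarget s hs)) ht).derivWithin
    (uniqueDiffOn_Icc hT t ht)

/-- Parallel vector fields exist locally along straight lines of a chart. -/
lemma exists_isParallelAlong_line (h : Metric n M) {p : M} {x₀ : Coord n}
    (hx₀ : x₀ ∈ (extChartAt (𝓡 n) p).target) (e y₀ : Coord n) :
    ∃ T > 0, (∀ t ∈ Icc 0 T, x₀ + t • e ∈ (extChartAt (𝓡 n) p).target) ∧
      ContMDiffOn 𝓘(ℝ, ℝ) (𝓡 n) ∞ (fun t : ℝ => chartPoint p (x₀ + t • e)) (Icc 0 T) ∧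
      ∃ y : ℝ → Coord n, y 0 = y₀ ∧
        IsParallelAlong (leviCivitaCoeff h) (fun t : ℝ => chartPoint p (x₀ + t • e)) 0 T
          (fun t => chartVector p (x₀ + t • e) (y t)) := by
  obtain ⟨ε, hε, y, hy0, hy⟩ := exists_linear_ode_solution (contDiffAt_christoffelMap h hx₀) e y₀
  have hline : Continuous fun t : ℝ => x₀ + t • e := by fun_prop
  have hmem : ∀ᶠ t in 𝓝 (0 : ℝ), x₀ + t • e ∈ (extChartAt (𝓡 n) p).target :=
    (hline.tendsto' 0 x₀ (by simp)).eventually ((isOpen_extChartAt_target p).mem_nhds hx₀)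
  obtain ⟨δ, hδ, hball⟩ := Metric.eventually_nhds_iff.1 hmem
  -- Halving keeps the closed interval `[0, T]` strictly inside both ranges.
  set T := min ε δ / 2 with hT
  have hTpos : 0 < T := by positivity
  have hTε : T < ε := by
    have := min_le_left ε δ
    linarith
  have hTδ : T < δ := by
    have := min_le_right ε δ
    linarith
  have htarget : ∀ t ∈ Icc 0 T, x₀ + t • e ∈ (extChartAt (𝓡 n) p).target := by
    intro t ht
    apply hball
    rw [Real.dist_eq, sub_zero, abs_of_nonneg ht.1]
    exact ht.2.trans_lt hTδ
  have hsmooth : ContMDiffOn 𝓘(ℝ, ℝ) (𝓡 n) ∞ (fun t : ℝ => chartPoint p (x₀ + t • e))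
      (Icc 0 T) := by
    have hl : ContMDiffOn 𝓘(ℝ, ℝ) 𝓘(ℝ, Coord n) ∞ (fun t : ℝ => x₀ + t • e) (Icc 0 T) := by
      rw [contMDiffOn_iff_contDiffOn]
      exact (contDiff_const.add (contDiff_id.smul contDiff_const)).contDiffOn
    exact (contMDiffOn_extChartAt_symm p).comp hl htarget
  refine ⟨T, hTpos, htarget, hsmooth, y, hy0, ?_⟩
  have hc1 := hsmooth.of_le (m := 1) (by norm_cast)
  refine isParallelAlong_of_chart hTpos hc1 p (fun t ht => chartPoint_mem (htarget t ht))
    fun t ht => ?_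
  rw [chartVelocity_line hTpos htarget ht, extChartAt_chartPoint (htarget t ht),
    vectorCoord_chartVector (htarget t ht)]
  have h2 := (hy t ⟨ht.1, ht.2.trans_lt hTε⟩).hasDerivWithinAt (s := Icc 0 T)
  exact h2.congr_of_mem (fun s hs => vectorCoord_chartVector (htarget s hs) _) ht

end Transport

/-! ### Comparison of the three parallel translations. -/

section Comparison

open Filter Topology Set

variable {n : ℕ} {M : Type*} [TopologicalSpace M] [ChartedSpace (Coord n) M]
  [IsManifold (𝓡 n) ∞ M] {h : Metric n M} {W : ∀ x : M, TangentSpace (𝓡 n) x}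

lemma randers_pos (hW : IsNavigationData h W) {q : M} {v : TangentSpace (𝓡 n) q} (hv : v ≠ 0) :
    0 < randers h W q v :=
  randersFormula_pos (h.pos q v hv) (hW.norm_lt_one q)

section Parallel

variable (hW : IsNavigationData h W) (hP : IsParallelField h W) {r : ℕ∞} (hr : 1 ≤ r)
include hW hP hr

/-- Since `W` is parallel along the curve, subtracting it before a linear translation and adding it
afterwards has no effect, and the factors `F(v)⁻¹` and `F(v)` cancel. -/
lemma coincide_natural_riemann_of_parallel :
    Coincide r (NaturalTranslates h W) (RiemannTranslates h) := by
  intro c a b hab hcr v w hv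
  have hc : ContMDiffOn 𝓘(ℝ, ℝ) (𝓡 n) 1 c (Icc a b) := hcr.of_le (by exact_mod_cast hr)
  have hWc := hP.isParallelAlong hab hc hW
  have hF := (randers_pos hW hv).ne'
  constructor
  · rintro ⟨-, u, ⟨V, hV, hVa, rfl⟩, rfl⟩
    refine ⟨_, (hV.add hab hc hWc).smul hab hc (randers h W (c a) v), ?_, rfl⟩
    simp only [hVa, sub_add_cancel, smul_smul, mul_inv_cancel₀ hF, one_smul]
  · rintro ⟨V, hV, rfl, rfl⟩
    refine ⟨hv, _, ⟨_, (hV.smul hab hc (randers h W (c a) (V a))⁻¹).sub hab hc hWc, rfl, rfl⟩, ?_⟩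
    simp only [sub_add_cancel, smul_smul, mul_inv_cancel₀ hF, one_smul]

lemma coincide_finsler_riemann_of_parallel :
    Coincide r (FinslerTranslates (randers h W)) (RiemannTranslates h) := by
  intro c a b hab hcr v w hv
  have hc : ContMDiffOn 𝓘(ℝ, ℝ) (𝓡 n) 1 c (Icc a b) := hcr.of_le (by exact_mod_cast hr)
  constructor
  · rintro ⟨V, hV0, hV, hVa, hVb⟩
    refine ⟨V, hV.congr_coeff fun p t ht hct k i => ?_, hVa, hVb⟩
    exact finslerCoeff_of_parallel hW (extChartAt_mem_target hct)
      (vectorCoord_ne_zero hct (hV0 t ht)) hP k i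
  · rintro ⟨V, hV, rfl, hVb⟩
    have hV0 := hV.ne_zero hab hc hv
    refine ⟨V, hV0, hV.congr_coeff fun p t ht hct k i => ?_, rfl, hVb⟩
    exact (finslerCoeff_of_parallel hW (extChartAt_mem_target hct)
      (vectorCoord_ne_zero hct (hV0 t ht)) hP k i).symm

lemma coincide_finsler_natural_of_parallel :
    Coincide r (FinslerTranslates (randers h W)) (NaturalTranslates h W) :=
  fun c a b hab hc v w hv =>
    (coincide_finsler_riemann_of_parallel hW hP hr c a b hab hc v w hv).trans
      (coincide_natural_riemann_of_parallel hW hP hr c a b hab hc v w hv).symm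

end Parallel

/-- If the two translations coincide, then a Finslerian parallel vector field is the natural
translate of its initial value at every time. -/
lemma eq_of_coincide {r : ℕ∞} (hr : 1 ≤ r)
    (hco : Coincide r (FinslerTranslates (randers h W)) (NaturalTranslates h W))
    {c : ℝ → M} {a b : ℝ} (hab : a < b) (hcr : ContMDiffOn 𝓘(ℝ, ℝ) (𝓡 n) r c (Icc a b))
    {U V : ∀ t, TangentSpace (𝓡 n) (c t)} (hV0 : ∀ t ∈ Icc a b, V t ≠ 0)
    (hV : IsParallelAlong (finslerCoeff (randers h W)) c a b V)
    (hU : IsParallelAlong (leviCivitaCoeff h) c a b U)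
    (hUa : U a = (randers h W (c a) (V a))⁻¹ • V a - W (c a)) :
    ∀ t ∈ Ioc a b, V t = randers h W (c a) (V a) • (U t + W (c t)) := by
  intro t ht
  have hc : ContMDiffOn 𝓘(ℝ, ℝ) (𝓡 n) 1 c (Icc a b) := hcr.of_le (by exact_mod_cast hr)
  have hsub : Icc a t ⊆ Icc a b := Icc_subset_Icc_right ht.2
  -- The coincidence is applied on `[a, t]`, which must be nondegenerate; this excludes `t = a` from
  -- the conclusion.
  obtain ⟨-, u, ⟨U', hU', hU'a, hU't⟩, hw⟩ := (hco c a t ht.1 (hcr.mono hsub) (V a) (V t)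
    (hV0 a ⟨le_rfl, hab.le⟩)).1
    ⟨V, fun s hs => hV0 s (hsub hs), hV.restrict hab hc ht.1 ht.2, rfl, rfl⟩
  have := hU'.unique ht.1 (hc.mono hsub) (hU.restrict hab hc ht.1 ht.2) (hU'a.trans hUa.symm) t
    ⟨ht.1.le, le_rfl⟩
  rw [hw, ← hU't, this]

/-- If the Finslerian and the natural parallel translations coincide, then the coefficients of the
two connections differ by the covariant derivative of `W`. -/
lemma finslerCoeff_of_coincide (hW : IsNavigationData h W) {r : ℕ∞} (hr : 1 ≤ r)
    (hco : Coincide r (FinslerTranslates (randers h W)) (NaturalTranslates h W))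
    {p : M} {x y : Coord n} (hx : x ∈ (extChartAt (𝓡 n) p).target) (hy : y ≠ 0) (k i : Fin n) :
    finslerCoeff (randers h W) p x y k i
      = christoffelMap h p x (EuclideanSpace.single i 1) y k
        - localRanders (chartMetric h p) (chartField W p) (x, y) *
          (fderiv ℝ (chartField W p) x (EuclideanSpace.single i 1)
            + christoffelMap h p x (EuclideanSpace.single i 1) (chartField W p x)) k := by
  set e : Coord n := EuclideanSpace.single i 1 with he
  set F := localRanders (chartMetric h p) (chartField W p) (x, y) with hF
  have hN := isLocalNavigation_chart hW p
  have hFpos : 0 < F := hN.localRanders_pos hx hy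
  -- The initial value is `y / F(y) - W`, so that `F(y) (U + W)` is the natural translate of `y`.
  -- The line is smooth, hence a test curve for every `r`.
  obtain ⟨T, hT, htarget, hsmooth, Y, hY0, hU⟩ :=
    exists_isParallelAlong_line h hx e (F⁻¹ • y - chartField W p x)
  have h0T : (0 : ℝ) ∈ Icc 0 T := ⟨le_rfl, hT.le⟩
  have hx0 : x + (0 : ℝ) • e = x := by simp
  set c : ℝ → M := fun t => chartPoint p (x + t • e) with hcdef
  set U : ∀ t, TangentSpace (𝓡 n) (c t) := fun t => chartVector p (x + t • e) (Y t) with hUdef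
  have hcr : ContMDiffOn 𝓘(ℝ, ℝ) (𝓡 n) r c (Icc 0 T) := hsmooth.of_le (by exact_mod_cast le_top)
  have hc : ContMDiffOn 𝓘(ℝ, ℝ) (𝓡 n) 1 c (Icc 0 T) := hcr.of_le (by exact_mod_cast hr)
  set v : TangentSpace (𝓡 n) (c 0) := chartVector p (x + (0 : ℝ) • e) y with hv
  have hx' : x + (0 : ℝ) • e ∈ (extChartAt (𝓡 n) p).target := htarget 0 h0T
  have hv0 : v ≠ 0 := chartVector_ne_zero hx' hy
  have hFv : randers h W (c 0) v = F := by
    rw [hv, hF]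
    refine (randers_chartVector h W hx' y).trans ?_
    rw [hx0]
  have hU0 : U 0 = F⁻¹ • v - W (c 0) := by
    have h1 : W (c 0) = chartVector p (x + (0 : ℝ) • e) (chartField W p x) :=
      (chartVector_vectorCoord hx' _).symm.trans
        (congrArg (chartVector p (x + (0 : ℝ) • e)) (congrArg (chartField W p) hx0))
    rw [h1, hUdef]
    simp only [hY0, chartVector, map_sub, map_smul]
    rfl
  -- The coincidence on `[0, T]` turns the natural translate into the end value of a Finslerian
  -- parallel field `V`; `hVt` then determines `V` at all times.
  obtain ⟨V, hV0, hV, hVa, hVb⟩ := (hco c 0 T hT hcr v (F • (U T + W (c T))) hv0).2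
    ⟨hv0, U T, by rw [hFv, ← hU0]; exact ⟨U, hU, rfl, rfl⟩, by rw [hFv]⟩
  have hVt : ∀ t ∈ Icc 0 T, V t = F • (U t + W (c t)) := by
    intro t ht
    rcases ht.1.eq_or_lt with rfl | htpos
    · rw [hVa, hU0, sub_add_cancel, smul_smul, mul_inv_cancel₀ hFpos.ne', one_smul]
    · rw [← hFv, ← hVa]
      refine eq_of_coincide hr hco hT hcr hV0 hV hU ?_ t ⟨htpos, ht.2⟩
      rw [hVa, hFv, hU0]
  have hcs : ∀ t ∈ Icc 0 T, c t ∈ (chartAt (Coord n) p).source := fun t ht =>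
    chartPoint_mem (htarget t ht)
  have hext : extChartAt (𝓡 n) p (c 0) = x := by
    rw [hcdef, extChartAt_chartPoint hx', hx0]
  have hvel : chartVelocity c 0 T p 0 = e := chartVelocity_line hT htarget h0T
  have dU := (isParallelAlong_leviCivita_iff hT hc).1 hU p 0 h0T (hcs 0 h0T)
  have dW : HasDerivWithinAt (fun s => vectorCoord p (c s) (W (c s)))
      (fderiv ℝ (chartField W p) x e) (Icc 0 T) 0 := by
    have hl : HasDerivWithinAt (fun t : ℝ => x + t • e) e (Icc 0 T) 0 := by
      simpa using (((hasDerivAt_id (0 : ℝ)).smul_const e).const_add x).hasDerivWithinAt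
    have hd : DifferentiableAt ℝ (chartField W p) (x + (0 : ℝ) • e) :=
      (hN.contDiffAt_field hx').differentiableAt (by simp)
    have := hd.hasFDerivAt.comp_hasDerivWithinAt 0 hl
    rwa [hx0] at this
  have dV := hV p 0 h0T (hcs 0 h0T) k
  have dV' := hasDerivWithinAt_coord.1 ((dU.add dW).const_smul F) k
  have dV'' := dV'.congr_of_mem (f₁ := fun s => vectorCoord p (c s) (V s) k) (fun s hs => by
    rw [hVt s hs, vectorCoord_smul, vectorCoord_add]
    rfl) h0T
  -- Two values of the one-sided derivative of `V` at `0` are compared: from the Finslerian parallel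
  -- equation and from `V = F (U + W)`.
  have key := (uniqueDiffOn_Icc hT 0 h0T).eq_deriv _ dV dV''
  have hcv : vectorCoord p (c 0) (V 0) = y := by
    rw [hVa]
    exact vectorCoord_chartVector hx' y
  have hcU : vectorCoord p (c 0) (U 0) = F⁻¹ • y - chartField W p x := by
    rw [← hY0]
    exact vectorCoord_chartVector hx' _
  simp only [derivWithin_chart_coord hT hc h0T (hcs 0 h0T), hvel, hext, hcv, hcU] at key
  have hsum : ∑ j, finslerCoeff (randers h W) p x y k j * e j
      = finslerCoeff (randers h W) p x y k i := by
    simp [he]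
  rw [hsum] at key
  simp only [map_sub, map_smul, PiLp.smul_apply, PiLp.add_apply, PiLp.neg_apply, PiLp.sub_apply,
    smul_eq_mul] at key ⊢
  have hFF : F * F⁻¹ = 1 := mul_inv_cancel₀ hFpos.ne'
  linear_combination -key + (christoffelMap h p x e y).ofLp k * hFF

lemma exists_ne_zero_apply_eq_zero (hn : 1 < n) (b : Coord n →L[ℝ] ℝ) :
    ∃ y : Coord n, y ≠ 0 ∧ b y = 0 := by
  have h1 : LinearMap.ker (b : Coord n →ₗ[ℝ] ℝ) ≠ ⊥ :=
    LinearMap.ker_ne_bot_of_finrank_lt (by simpa using hn)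
  obtain ⟨y, hy, hy0⟩ := Submodule.exists_mem_ne_zero_of_ne_bot h1
  exact ⟨y, hy0, hy⟩

lemma isParallelField_of_coincide (hW : IsNavigationData h W) {r : ℕ∞} (hr : 1 ≤ r) (hn : n ≠ 1)
    (hco : Coincide r (FinslerTranslates (randers h W)) (NaturalTranslates h W)) :
    IsParallelField h W := by
  rw [isParallelField_iff hW]
  intro p x hx u
  ext k
  -- The component index `k` shows `n > 0`, so `n ≠ 1` leaves `n ≥ 2`; for `n = 0` there is nothing
  -- to prove.
  have hn' : 1 < n := by
    have := k.pos
    omega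
  have hN := isLocalNavigation_chart hW p
  set pr : Coord n →L[ℝ] ℝ := EuclideanSpace.proj k with hpr
  set Γ := christoffelMap h p x with hΓ
  -- Here `γ` is the `k`-th component of `Γ` and `b` that of the covariant derivative of `W`; the
  -- potential is the spray coefficient `Gᵏ`.
  have hb := hN.eq_zero_of_hasFDerivAt hx (exists_ne_zero_apply_eq_zero hn')
    (G := fun z => sprayCoeff (randers h W) p x z k)
    (γ := (ContinuousLinearMap.compL ℝ (Coord n) (Coord n) ℝ pr).comp Γ)
    (b := pr.comp (fderiv ℝ (chartField W p) x + Γ.flip (chartField W p x)))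
    (fun a b => by
      simp [hN.leviCivita_symm hx (isLeviCivitaAt_christoffelMap h hx) a b, hΓ])
    (fun y hy => by
      refine (differentiableAt_sprayCoeff hW hx hy k).hasFDerivAt.congr_fderiv ?_
      ext v
      rw [clm_apply_eq_sum, clm_apply_eq_sum (_ - _)]
      refine Finset.sum_congr rfl fun i _ => ?_
      congr 1
      refine (finslerCoeff_of_coincide hW hr hco hx hy k i).trans ?_
      rw [hN.leviCivita_symm hx (isLeviCivitaAt_christoffelMap h hx) _ y]
      rfl)
  exact DFunLike.congr_fun hb u

end Comparison

end Navigation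

end

theorem mainTheorem9 {n : ℕ} {M : Type*} [TopologicalSpace M] [ChartedSpace (Navigation.Coord n) M]
    [IsManifold (𝓡 n) ∞ M] [T2Space M] [ConnectedSpace M]
    (h : Navigation.Metric n M) (W : ∀ x : M, TangentSpace (𝓡 n) x)
    (hW : Navigation.IsNavigationData h W) (r : ℕ∞) (hr : 1 ≤ r) :
    (n ≠ 1 →
      (Navigation.Coincide r (Navigation.FinslerTranslates (Navigation.randers h W))
          (Navigation.NaturalTranslates h W) ↔
        Navigation.IsParallelField h W)) ∧
    (Navigation.IsParallelField h W →
      Navigation.Coincide r (Navigation.NaturalTranslates h W)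
          (Navigation.RiemannTranslates h) ∧
      Navigation.Coincide r (Navigation.FinslerTranslates (Navigation.randers h W))
          (Navigation.RiemannTranslates h) ∧
      Navigation.IsBerwald (Navigation.randers h W)) :=
  ⟨fun hn => ⟨Navigation.isParallelField_of_coincide hW hr hn,
      fun hP => Navigation.coincide_finsler_natural_of_parallel hW hP hr⟩,
    fun hP => ⟨Navigation.coincide_natural_riemann_of_parallel hW hP hr,
      Navigation.coincide_finsler_riemann_of_parallel hW hP hr,
      Navigation.isBerwald_of_parallel hW hP⟩⟩
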